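/- Throughout, 2-categories are strict, $\mathcal B,\mathcal C,\mathcal D$ are 2-categories, a lax functor $F$ has unitors $\iota\colon \mathrm{id}\to F(\mathrm{id})$ and compositors $\gamma_{g,f}\colon F(g)F(f)\to F(gf)$, and a pseudofunctor is a lax functor whose unitors and compositors are all invertible. A (lax or pseudo-) bifunctor is a (lax or pseudo-) functor $\mathcal B\times\mathcal C\to\mathcal D$. An oplax transformation $\rho\colon F\to G$ has 2-morphism components $\rho_f\colon \rho_Y F(f)\to G(f)\rho_X$ for $f\colon X\to Y$; it is pseudonatural if all $\rho_f$ are invertible. A distributive law consists of families of lax functors $M_B\colon\mathcal C\to\mathcal D$ ($B\in\mathcal B$) and $L_C\colon\mathcal B\to\mathcal D$ ($C\in\mathcal C$) with $L_C(B)=M_B(C)$, and 2-morphisms $\sigma_{f,g}\colon L_{C_2}(f)M_{B_1}(g)\to M_{B_2}(g)L_{C_1}(f)$ for $f\colon B_1\to B_2$, $g\colon C_1\to C_2$, natural in both variables with respect to 2-morphisms and compatible with the unitors and compositors of both families. It is invertible if every $\sigma_{f,g}$ is. A morphism of distributive laws $\sigma^1\to\sigma^2$ is a pair of families of oplax transformations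 $\theta^B\colon M^1_B\to M^2_B$, $\theta^C\colon L^1_C\to L^2_C$ with $\theta^B_C=\theta^C_B$ satisfying the Yang–Baxter equation $$(\sigma^2_{f,g}\,\theta_{B_1,C_1})\circ(L^2_{C_2}(f)\,\theta^{B_1}_g)\circ(\theta^{C_2}_f\,M^1_{B_1}(g)) = (M^2_{B_2}(g)\,\theta^{C_1}_f)\circ(\theta^{B_2}_g\,L^1_{C_1}(f))\circ(\theta_{B_2,C_2}\,\sigma^1_{f,g}),$$ where $\theta_{B,C}=\theta^B_C=\theta^C_B$; a 2-morphism is a family of 2-morphisms indexed by $\mathcal B\times\mathcal C$ that is a modification in each variable separately. The collation of a distributive law is the lax bifunctor $P$ with $P(B,C)=M_B(C)$, $P(f,g)=M_{B_2}(g)L_{C_1}(f)$, $P(\alpha,\beta)=M_{B_2}(\beta)\ast L_{C_1}(\alpha)$, unitors $\iota^{M_B}_C\ast\iota^{L_C}_B$, and compositors obtained by applying $\sigma$ to the two inner factors and then the compositors of $M$ and $L$. Collation of a morphism $\theta$ is the oplax transformation with components $\theta_{B,C}$ and $(M^2_{B_2}(g)\,\theta^{C_1}_f)\circ(\theta^{B_2}_g\,L^1_{C_1}(f))$;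 2-morphisms collate to the modifications with the same components. Theorem. (1) If $\sigma$ is an invertible distributive law between families of pseudofunctors, then its collation $P$ is a pseudo-bifunctor. For every $B$ there is a pseudonatural isomorphism $\kappa^B\colon M_B\to P(B,-)$ with identity 1-morphism components and 2-morphism components $M_B(g)\,\iota^{L_{C_1}}_B$ for $g\colon C_1\to C_2$, and for every $C$ there is a pseudonatural isomorphism $\kappa^C\colon L_C\to P(-,C)$ with identity 1-morphism components and 2-morphism components $\iota^{M_{B_2}}_C\,L_C(f)$ for $f\colon B_1\to B_2$. (2) Conversely, if $P'=(P',\gamma',\iota')$ is a pseudo-bifunctor, then $L_C=P'(-,C)$, $M_B=P'(B,-)$ and $\sigma_{f,g}=\gamma'^{-1}_{(\mathrm{id},g),(f,\mathrm{id})}\circ\gamma'_{(f,\mathrm{id}),(\mathrm{id},g)}$ form an invertible distributive law of pseudofunctors, and there is a pseudonatural isomorphism from its collation to $P'$ with identity 1-morphism components and 2-morphism components $\gamma'_{(\mathrm{id},g),(f,\mathrm{id})}$. (3) Consider the full sub-2-category, on the invertible distributive laws of pseudofunctors, of the 2-category of distributive laws, and the full sub-2-category, on the pseudo-bifunctors,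 of the 2-category of lax functors $\mathcal B\times\mathcal C\to\mathcal D$, oplax transformations and modifications. Collation is a strict 2-functor $\overline K$ from the former to the latter; the assignment in (2), together with restriction of oplax transformations and modifications to each variable, is a strict 2-functor $T$ in the other direction; and these form an equivalence of 2-categories: there are strict 2-natural isomorphisms $\kappa\colon\mathrm{Id}\cong T\overline K$ and $\lambda\colon\overline K T\cong\mathrm{Id}$, whose components are the isomorphisms $(\kappa^B)_B,(\kappa^C)_C$ of (1) and the isomorphisms of (2). -/

import Mathlib

open CategoryTheory Bicategory
open scoped CategoryTheory.Lax.OplaxTrans CategoryTheory.Lax.OplaxTrans.LaxFunctor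

universe w₁ w₂ w₃ v₁ v₂ v₃ u₁ u₂ u₃

namespace CategoryTheory

section

variable {B : Type u₁} [Bicategory.{w₁, v₁} B] {C : Type u₂} [Bicategory.{w₂, v₂} C]
  {D : Type u₃} [Bicategory.{w₃, v₃} D]

/-- A lax functor `B ⥤ᴸ D` with prescribed action on objects `ob : B → D`. -/
structure LaxOn (ob : B → D) where
  map {a b : B} (f : a ⟶ b) : ob a ⟶ ob b
  map₂ {a b : B} {f g : a ⟶ b} (η : f ⟶ g) : map f ⟶ map g
  map₂_id {a b : B} (f : a ⟶ b) : map₂ (𝟙 f) = 𝟙 (map f)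
  map₂_comp {a b : B} {f g h : a ⟶ b} (η : f ⟶ g) (θ : g ⟶ h) :
    map₂ (η ≫ θ) = map₂ η ≫ map₂ θ
  mapId (a : B) : 𝟙 (ob a) ⟶ map (𝟙 a)
  mapComp {a b c : B} (f : a ⟶ b) (g : b ⟶ c) : map f ≫ map g ⟶ map (f ≫ g)
  mapComp_naturality_left {a b c : B} {f f' : a ⟶ b} (η : f ⟶ f') (g : b ⟶ c) :
    mapComp f g ≫ map₂ (η ▷ g) = map₂ η ▷ map g ≫ mapComp f' g
  mapComp_naturality_right {a b c : B} (f : a ⟶ b) {g g' : b ⟶ c} (η : g ⟶ g') :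
    mapComp f g ≫ map₂ (f ◁ η) = map f ◁ map₂ η ≫ mapComp f g'
  map₂_associator {a b c d : B} (f : a ⟶ b) (g : b ⟶ c) (h : c ⟶ d) :
    mapComp f g ▷ map h ≫ mapComp (f ≫ g) h ≫ map₂ (α_ f g h).hom =
      (α_ (map f) (map g) (map h)).hom ≫ map f ◁ mapComp g h ≫ mapComp f (g ≫ h)
  map₂_leftUnitor {a b : B} (f : a ⟶ b) :
    map₂ (λ_ f).inv = (λ_ (map f)).inv ≫ mapId a ▷ map f ≫ mapComp (𝟙 a) f
  map₂_rightUnitor {a b : B} (f : a ⟶ b) :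
    map₂ (ρ_ f).inv = (ρ_ (map f)).inv ≫ map f ◁ mapId b ≫ mapComp f (𝟙 b)

namespace LaxOn

/-- The underlying lax functor. -/
@[simps]
def toLax {ob : B → D} (F : LaxOn ob) : B ⥤ᴸ D where
  obj := ob
  map := F.map
  map₂ := F.map₂
  map₂_id := F.map₂_id
  map₂_comp := F.map₂_comp
  mapId := F.mapId
  mapComp := F.mapComp
  mapComp_naturality_left := F.mapComp_naturality_left
  mapComp_naturality_right := F.mapComp_naturality_right
  map₂_associator := F.map₂_associator
  map₂_leftUnitor := F.map₂_leftUnitor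
  map₂_rightUnitor := F.map₂_rightUnitor

/-- Every lax functor is a lax functor on its own object function. -/
def of (F : B ⥤ᴸ D) : LaxOn F.obj where
  map := F.map
  map₂ := F.map₂
  map₂_id := F.map₂_id
  map₂_comp := F.map₂_comp
  mapId := F.mapId
  mapComp := F.mapComp
  mapComp_naturality_left := F.mapComp_naturality_left
  mapComp_naturality_right := F.mapComp_naturality_right
  map₂_associator := F.map₂_associator
  map₂_leftUnitor := F.map₂_leftUnitor
  map₂_rightUnitor := F.map₂_rightUnitor

end LaxOn

variable (B C D) in
/-- The data of a distributive law between two families of lax functors, before imposing the axioms: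
lax functors `M b : C ⥤ᴸ D` and `L c : B ⥤ᴸ D` with `(L c) b = (M b) c = obj b c` on objects, and
2-morphisms `σ f g : L_{c₂}(f) ∘ M_{b₁}(g) ⟶ M_{b₂}(g) ∘ L_{c₁}(f)`. -/
structure DistData where
  obj : B → C → D
  M (b : B) : LaxOn (obj b)
  L (c : C) : LaxOn (fun b => obj b c)
  σ {b₁ b₂ : B} (f : b₁ ⟶ b₂) {c₁ c₂ : C} (g : c₁ ⟶ c₂) :
    (M b₁).map g ≫ (L c₂).map f ⟶ (L c₁).map f ≫ (M b₂).map g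

/-- The six axioms of a distributive law of lax functors: compatibility of `σ` with the compositors,
the unitors and the 2-morphisms of both families. -/
structure DistData.IsDistLaw (S : DistData B C D) : Prop where
  comp_M {b₁ b₂ : B} (f : b₁ ⟶ b₂) {c₁ c₂ c₃ : C} (g₁ : c₁ ⟶ c₂) (g₂ : c₂ ⟶ c₃) :
    (S.M b₁).mapComp g₁ g₂ ▷ (S.L c₃).map f ≫ S.σ f (g₁ ≫ g₂) =
      (α_ _ _ _).hom ≫ (S.M b₁).map g₁ ◁ S.σ f g₂ ≫ (α_ _ _ _).inv ≫
        S.σ f g₁ ▷ (S.M b₂).map g₂ ≫ (α_ _ _ _).hom ≫ (S.L c₁).map f ◁ (S.M b₂).mapComp g₁ g₂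
  comp_L {b₁ b₂ b₃ : B} (f₁ : b₁ ⟶ b₂) (f₂ : b₂ ⟶ b₃) {c₁ c₂ : C} (g : c₁ ⟶ c₂) :
    (S.M b₁).map g ◁ (S.L c₂).mapComp f₁ f₂ ≫ S.σ (f₁ ≫ f₂) g =
      (α_ _ _ _).inv ≫ S.σ f₁ g ▷ (S.L c₂).map f₂ ≫ (α_ _ _ _).hom ≫
        (S.L c₁).map f₁ ◁ S.σ f₂ g ≫ (α_ _ _ _).inv ≫ (S.L c₁).mapComp f₁ f₂ ▷ (S.M b₃).map g
  unit_M {b₁ b₂ : B} (f : b₁ ⟶ b₂) (c : C) :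
    (S.M b₁).mapId c ▷ (S.L c).map f ≫ S.σ f (𝟙 c) =
      (λ_ _).hom ≫ (ρ_ _).inv ≫ (S.L c).map f ◁ (S.M b₂).mapId c
  unit_L (b : B) {c₁ c₂ : C} (g : c₁ ⟶ c₂) :
    (S.M b).map g ◁ (S.L c₂).mapId b ≫ S.σ (𝟙 b) g =
      (ρ_ _).hom ≫ (λ_ _).inv ≫ (S.L c₁).mapId b ▷ (S.M b).map g
  nat_M {b₁ b₂ : B} (f : b₁ ⟶ b₂) {c₁ c₂ : C} {g g' : c₁ ⟶ c₂} (β : g ⟶ g') :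
    (S.M b₁).map₂ β ▷ (S.L c₂).map f ≫ S.σ f g' = S.σ f g ≫ (S.L c₁).map f ◁ (S.M b₂).map₂ β
  nat_L {b₁ b₂ : B} {f f' : b₁ ⟶ b₂} (α : f ⟶ f') {c₁ c₂ : C} (g : c₁ ⟶ c₂) :
    (S.M b₁).map g ◁ (S.L c₂).map₂ α ≫ S.σ f' g = S.σ f g ≫ (S.L c₁).map₂ α ▷ (S.M b₂).map g

variable (B C D) in
/-- A distributive law of lax functors. -/
structure DistLaw extends DistData B C D where
  law : toDistData.IsDistLaw

namespace DistData

variable (S : DistData B C D)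

/-- The action of the collated lax bifunctor on a pair of 2-morphisms. -/
abbrev collateMap₂ {b₁ b₂ : B} {f f' : b₁ ⟶ b₂} (α : f ⟶ f') {c₁ c₂ : C} {g g' : c₁ ⟶ c₂}
    (β : g ⟶ g') :
    (S.L c₁).map f ≫ (S.M b₂).map g ⟶ (S.L c₁).map f' ≫ (S.M b₂).map g' :=
  (S.L c₁).map₂ α ▷ (S.M b₂).map g ≫ (S.L c₁).map f' ◁ (S.M b₂).map₂ β

/-- The unitor of the collated lax bifunctor. -/
abbrev collateId (b : B) (c : C) : 𝟙 (S.obj b c) ⟶ (S.L c).map (𝟙 b) ≫ (S.M b).map (𝟙 c) :=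
  (λ_ _).inv ≫ (S.L c).mapId b ▷ 𝟙 (S.obj b c) ≫ (S.L c).map (𝟙 b) ◁ (S.M b).mapId c

/-- The compositor of the collated lax bifunctor: apply `σ` to the two inner factors, then
the compositors of both families. -/
abbrev collateComp {b₁ b₂ b₃ : B} (f : b₁ ⟶ b₂) (f' : b₂ ⟶ b₃) {c₁ c₂ c₃ : C} (g : c₁ ⟶ c₂)
    (g' : c₂ ⟶ c₃) :
    ((S.L c₁).map f ≫ (S.M b₂).map g) ≫ ((S.L c₂).map f' ≫ (S.M b₃).map g') ⟶
      (S.L c₁).map (f ≫ f') ≫ (S.M b₃).map (g ≫ g') :=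
  (α_ _ _ _).hom ≫ (S.L c₁).map f ◁ ((α_ _ _ _).inv ≫ S.σ f' g ▷ (S.M b₃).map g' ≫
    (α_ _ _ _).hom) ≫ (α_ _ _ _).inv ≫
      (S.L c₁).mapComp f f' ▷ ((S.M b₃).map g ≫ (S.M b₃).map g') ≫
        (S.L c₁).map (f ≫ f') ◁ (S.M b₃).mapComp g g'

theorem collateMap₂_comp {b₁ b₂ : B} {f f' f'' : b₁ ⟶ b₂} (α : f ⟶ f') (α' : f' ⟶ f'')
    {c₁ c₂ : C} {g g' g'' : c₁ ⟶ c₂} (β : g ⟶ g') (β' : g' ⟶ g'') :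
    S.collateMap₂ (α ≫ α') (β ≫ β') = S.collateMap₂ α β ≫ S.collateMap₂ α' β' := by
  dsimp only [collateMap₂]
  simp only [LaxOn.map₂_comp, Bicategory.whiskerLeft_comp, comp_whiskerRight, Category.assoc]
  rw [whisker_exchange_assoc]

variable {S}

theorem collateComp_naturality_left (hS : S.IsDistLaw) {b₁ b₂ b₃ : B} {f f' : b₁ ⟶ b₂}
    (α : f ⟶ f') (h : b₂ ⟶ b₃) {c₁ c₂ c₃ : C} {g g' : c₁ ⟶ c₂} (β : g ⟶ g') (k : c₂ ⟶ c₃) :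
    S.collateComp f h g k ≫ S.collateMap₂ (α ▷ h) (β ▷ k) =
      S.collateMap₂ α β ▷ ((S.L c₂).map h ≫ (S.M b₃).map k) ≫ S.collateComp f' h g' k := by
  dsimp only [collateComp, collateMap₂]
  calc
    _ = 𝟙 _ ⊗≫ (S.L c₁).map f ◁ S.σ h g ▷ (S.M b₃).map k ⊗≫
        (S.L c₁).mapComp f h ▷ ((S.M b₃).map g ≫ (S.M b₃).map k) ⊗≫
        ((S.L c₁).map (f ≫ h) ◁ (S.M b₃).mapComp g k ≫
          (S.L c₁).map₂ (α ▷ h) ▷ (S.M b₃).map (g ≫ k)) ⊗≫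
        (S.L c₁).map (f' ≫ h) ◁ (S.M b₃).map₂ (β ▷ k) ⊗≫ 𝟙 _ := by
      bicategory
    _ = 𝟙 _ ⊗≫ (S.L c₁).map f ◁ S.σ h g ▷ (S.M b₃).map k ⊗≫
        ((S.L c₁).mapComp f h ≫ (S.L c₁).map₂ (α ▷ h)) ▷ ((S.M b₃).map g ≫ (S.M b₃).map k) ⊗≫
        (S.L c₁).map (f' ≫ h) ◁ ((S.M b₃).mapComp g k ≫ (S.M b₃).map₂ (β ▷ k)) ⊗≫ 𝟙 _ := by
      rw [whisker_exchange]; bicategory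
    _ = 𝟙 _ ⊗≫ ((S.L c₁).map f ◁ S.σ h g ≫
          (S.L c₁).map₂ α ▷ ((S.L c₁).map h ≫ (S.M b₃).map g)) ▷ (S.M b₃).map k ⊗≫
        ((S.L c₁).mapComp f' h ▷ (S.M b₃).map g ≫
          (S.L c₁).map (f' ≫ h) ◁ (S.M b₃).map₂ β) ▷ (S.M b₃).map k ⊗≫
        (S.L c₁).map (f' ≫ h) ◁ (S.M b₃).mapComp g' k ⊗≫ 𝟙 _ := by
      rw [LaxOn.mapComp_naturality_left, LaxOn.mapComp_naturality_left]; bicategory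
    _ = 𝟙 _ ⊗≫ (S.L c₁).map₂ α ▷ ((S.M b₂).map g ≫ (S.L c₂).map h ≫ (S.M b₃).map k) ⊗≫
        (S.L c₁).map f' ◁ (S.σ h g ≫ (S.L c₁).map h ◁ (S.M b₃).map₂ β) ▷ (S.M b₃).map k ⊗≫
        (S.L c₁).mapComp f' h ▷ ((S.M b₃).map g' ≫ (S.M b₃).map k) ⊗≫
        (S.L c₁).map (f' ≫ h) ◁ (S.M b₃).mapComp g' k ⊗≫ 𝟙 _ := by
      rw [whisker_exchange ((S.L c₁).map₂ α) (S.σ h g),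
        ← whisker_exchange ((S.L c₁).mapComp f' h) ((S.M b₃).map₂ β)]; bicategory
    _ = _ := by
      rw [← hS.nat_M]; bicategory

theorem collateComp_naturality_right (hS : S.IsDistLaw) {b₁ b₂ b₃ : B} (f : b₁ ⟶ b₂)
    {h h' : b₂ ⟶ b₃} (α : h ⟶ h') {c₁ c₂ c₃ : C} (g : c₁ ⟶ c₂) {k k' : c₂ ⟶ c₃} (β : k ⟶ k') :
    S.collateComp f h g k ≫ S.collateMap₂ (f ◁ α) (g ◁ β) =
      ((S.L c₁).map f ≫ (S.M b₂).map g) ◁ S.collateMap₂ α β ≫ S.collateComp f h' g k' := by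
  dsimp only [collateComp, collateMap₂]
  calc
    _ = 𝟙 _ ⊗≫ (S.L c₁).map f ◁ S.σ h g ▷ (S.M b₃).map k ⊗≫
        (S.L c₁).mapComp f h ▷ ((S.M b₃).map g ≫ (S.M b₃).map k) ⊗≫
        ((S.L c₁).map (f ≫ h) ◁ (S.M b₃).mapComp g k ≫
          (S.L c₁).map₂ (f ◁ α) ▷ (S.M b₃).map (g ≫ k)) ⊗≫
        (S.L c₁).map (f ≫ h') ◁ (S.M b₃).map₂ (g ◁ β) ⊗≫ 𝟙 _ := by
      bicategory
    _ = 𝟙 _ ⊗≫ (S.L c₁).map f ◁ S.σ h g ▷ (S.M b₃).map k ⊗≫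
        ((S.L c₁).mapComp f h ≫ (S.L c₁).map₂ (f ◁ α)) ▷ ((S.M b₃).map g ≫ (S.M b₃).map k) ⊗≫
        (S.L c₁).map (f ≫ h') ◁ ((S.M b₃).mapComp g k ≫ (S.M b₃).map₂ (g ◁ β)) ⊗≫ 𝟙 _ := by
      rw [whisker_exchange]; bicategory
    _ = 𝟙 _ ⊗≫ (S.L c₁).map f ◁ (S.σ h g ≫ (S.L c₁).map₂ α ▷ (S.M b₃).map g) ▷ (S.M b₃).map k ⊗≫
        ((S.L c₁).mapComp f h' ▷ ((S.M b₃).map g ≫ (S.M b₃).map k) ≫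
          (S.L c₁).map (f ≫ h') ◁ ((S.M b₃).map g ◁ (S.M b₃).map₂ β)) ⊗≫
        (S.L c₁).map (f ≫ h') ◁ (S.M b₃).mapComp g k' ⊗≫ 𝟙 _ := by
      rw [LaxOn.mapComp_naturality_right, LaxOn.mapComp_naturality_right]; bicategory
    _ = 𝟙 _ ⊗≫ (S.L c₁).map f ◁ (S.M b₂).map g ◁ (S.L c₂).map₂ α ▷ (S.M b₃).map k ⊗≫
        (S.L c₁).map f ◁ (S.σ h' g ▷ (S.M b₃).map k ≫
          ((S.L c₁).map h' ≫ (S.M b₃).map g) ◁ (S.M b₃).map₂ β) ⊗≫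
        (S.L c₁).mapComp f h' ▷ ((S.M b₃).map g ≫ (S.M b₃).map k') ⊗≫
        (S.L c₁).map (f ≫ h') ◁ (S.M b₃).mapComp g k' ⊗≫ 𝟙 _ := by
      rw [← hS.nat_L, ← whisker_exchange]; bicategory
    _ = _ := by
      rw [← whisker_exchange]; bicategory

theorem collate_associator (hS : S.IsDistLaw) {b₁ b₂ b₃ b₄ : B} (f : b₁ ⟶ b₂) (g : b₂ ⟶ b₃)
    (h : b₃ ⟶ b₄) {c₁ c₂ c₃ c₄ : C} (f' : c₁ ⟶ c₂) (g' : c₂ ⟶ c₃) (h' : c₃ ⟶ c₄) :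
    S.collateComp f g f' g' ▷ ((S.L c₃).map h ≫ (S.M b₄).map h') ≫
        S.collateComp (f ≫ g) h (f' ≫ g') h' ≫ S.collateMap₂ (α_ f g h).hom (α_ f' g' h').hom =
      (α_ _ _ _).hom ≫ ((S.L c₁).map f ≫ (S.M b₂).map f') ◁ S.collateComp g h g' h' ≫
        S.collateComp f (g ≫ h) f' (g' ≫ h') := by
  dsimp only [collateComp, collateMap₂]
  calc
    _ = 𝟙 _ ⊗≫ (S.L c₁).map f ◁ S.σ g f' ▷
          ((S.M b₃).map g' ≫ (S.L c₃).map h ≫ (S.M b₄).map h') ⊗≫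
        (S.L c₁).mapComp f g ▷ ((S.M b₃).map f' ≫ (S.M b₃).map g' ≫ (S.L c₃).map h ≫
          (S.M b₄).map h') ⊗≫
        (S.L c₁).map (f ≫ g) ◁ ((S.M b₃).mapComp f' g' ▷ (S.L c₃).map h ≫
          S.σ h (f' ≫ g')) ▷ (S.M b₄).map h' ⊗≫
        (S.L c₁).mapComp (f ≫ g) h ▷ ((S.M b₄).map (f' ≫ g') ≫ (S.M b₄).map h') ⊗≫
        ((S.L c₁).map ((f ≫ g) ≫ h) ◁ (S.M b₄).mapComp (f' ≫ g') h' ≫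
          (S.L c₁).map₂ (α_ f g h).hom ▷ (S.M b₄).map ((f' ≫ g') ≫ h')) ⊗≫
        (S.L c₁).map (f ≫ g ≫ h) ◁ (S.M b₄).map₂ (α_ f' g' h').hom ⊗≫ 𝟙 _ := by
      bicategory
    _ = 𝟙 _ ⊗≫ (S.L c₁).map f ◁ S.σ g f' ▷
          ((S.M b₃).map g' ≫ (S.L c₃).map h ≫ (S.M b₄).map h') ⊗≫
        ((S.L c₁).mapComp f g ▷ ((S.M b₃).map f' ≫ (S.M b₃).map g' ≫ (S.L c₃).map h) ≫
          (S.L c₁).map (f ≫ g) ◁ ((S.M b₃).map f' ◁ S.σ h g' ≫ (α_ _ _ _).inv ≫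
            S.σ h f' ▷ (S.M b₄).map g' ≫ (α_ _ _ _).hom)) ▷ (S.M b₄).map h' ⊗≫
        (((S.L c₁).map (f ≫ g) ≫ (S.L c₁).map h) ◁ ((S.M b₄).mapComp f' g' ▷ (S.M b₄).map h') ≫
          ((S.L c₁).mapComp (f ≫ g) h ≫ (S.L c₁).map₂ (α_ f g h).hom) ▷
            ((S.M b₄).map (f' ≫ g') ≫ (S.M b₄).map h')) ⊗≫
        (S.L c₁).map (f ≫ g ≫ h) ◁ ((S.M b₄).mapComp (f' ≫ g') h' ≫
          (S.M b₄).map₂ (α_ f' g' h').hom) ⊗≫ 𝟙 _ := by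
      rw [whisker_exchange, hS.comp_M]; bicategory
    _ = 𝟙 _ ⊗≫ (S.L c₁).map f ◁ S.σ g f' ▷
          ((S.M b₃).map g' ≫ (S.L c₃).map h ≫ (S.M b₄).map h') ⊗≫
        ((S.L c₁).map f ≫ (S.L c₁).map g) ◁ ((S.M b₃).map f' ◁ S.σ h g' ≫ (α_ _ _ _).inv ≫
            S.σ h f' ▷ (S.M b₄).map g' ≫ (α_ _ _ _).hom) ▷ (S.M b₄).map h' ⊗≫
        ((S.L c₁).mapComp f g ▷ (S.L c₁).map h ≫ (S.L c₁).mapComp (f ≫ g) h ≫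
          (S.L c₁).map₂ (α_ f g h).hom) ▷
            (((S.M b₄).map f' ≫ (S.M b₄).map g') ≫ (S.M b₄).map h') ⊗≫
        (S.L c₁).map (f ≫ g ≫ h) ◁ ((S.M b₄).mapComp f' g' ▷ (S.M b₄).map h' ≫
          (S.M b₄).mapComp (f' ≫ g') h' ≫ (S.M b₄).map₂ (α_ f' g' h').hom) ⊗≫ 𝟙 _ := by
      rw [← whisker_exchange, whisker_exchange
        ((S.L c₁).mapComp (f ≫ g) h ≫ (S.L c₁).map₂ (α_ f g h).hom)]; bicategory
    _ = 𝟙 _ ⊗≫ (S.L c₁).map f ◁ (S.σ g f' ▷ ((S.M b₃).map g' ≫ (S.L c₃).map h) ≫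
          ((S.L c₁).map g ≫ (S.M b₃).map f') ◁ S.σ h g') ▷ (S.M b₄).map h' ⊗≫
        (S.L c₁).map f ◁ (S.L c₁).map g ◁ S.σ h f' ▷ ((S.M b₄).map g' ≫ (S.M b₄).map h') ⊗≫
        (S.L c₁).map f ◁ (S.L c₁).mapComp g h ▷
          ((S.M b₄).map f' ≫ (S.M b₄).map g' ≫ (S.M b₄).map h') ⊗≫
        ((S.L c₁).mapComp f (g ≫ h) ▷
          ((S.M b₄).map f' ≫ (S.M b₄).map g' ≫ (S.M b₄).map h') ≫
        (S.L c₁).map (f ≫ g ≫ h) ◁ ((S.M b₄).map f' ◁ (S.M b₄).mapComp g' h')) ⊗≫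
        (S.L c₁).map (f ≫ g ≫ h) ◁ (S.M b₄).mapComp f' (g' ≫ h') ⊗≫ 𝟙 _ := by
      rw [LaxOn.map₂_associator, LaxOn.map₂_associator]; bicategory
    _ = 𝟙 _ ⊗≫ (S.L c₁).map f ◁ (S.M b₂).map f' ◁ (S.L c₂).map g ◁ S.σ h g' ▷ (S.M b₄).map h' ⊗≫
        (S.L c₁).map f ◁ ((α_ ((S.M b₂).map f') ((S.L c₂).map g) ((S.L c₂).map h)).inv ≫
          S.σ g f' ▷ (S.L c₂).map h ≫
          (α_ ((S.L c₁).map g) ((S.M b₃).map f') ((S.L c₂).map h)).hom ≫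
          (S.L c₁).map g ◁ S.σ h f' ≫
          (α_ ((S.L c₁).map g) ((S.L c₁).map h) ((S.M b₄).map f')).inv ≫
            (S.L c₁).mapComp g h ▷ (S.M b₄).map f') ▷ ((S.M b₄).map g' ≫ (S.M b₄).map h') ⊗≫
        (S.L c₁).map f ◁ (S.L c₁).map (g ≫ h) ◁ (S.M b₄).map f' ◁ (S.M b₄).mapComp g' h' ⊗≫
        (S.L c₁).mapComp f (g ≫ h) ▷ ((S.M b₄).map f' ≫ (S.M b₄).map (g' ≫ h')) ⊗≫
        (S.L c₁).map (f ≫ g ≫ h) ◁ (S.M b₄).mapComp f' (g' ≫ h') ⊗≫ 𝟙 _ := by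
      rw [← whisker_exchange (S.σ g f') (S.σ h g'), ← whisker_exchange
        ((S.L c₁).mapComp f (g ≫ h)) ((S.M b₄).map f' ◁ (S.M b₄).mapComp g' h')]
      bicategory
    _ = 𝟙 _ ⊗≫ (S.L c₁).map f ◁ (S.M b₂).map f' ◁ (S.L c₂).map g ◁ S.σ h g' ▷ (S.M b₄).map h' ⊗≫
        (S.L c₁).map f ◁ (S.M b₂).map f' ◁ (S.L c₂).mapComp g h ▷
          ((S.M b₄).map g' ≫ (S.M b₄).map h') ⊗≫
        (S.L c₁).map f ◁ (S.σ (g ≫ h) f' ▷ ((S.M b₄).map g' ≫ (S.M b₄).map h') ≫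
          ((S.L c₁).map (g ≫ h) ≫ (S.M b₄).map f') ◁ (S.M b₄).mapComp g' h') ⊗≫
        (S.L c₁).mapComp f (g ≫ h) ▷ ((S.M b₄).map f' ≫ (S.M b₄).map (g' ≫ h')) ⊗≫
        (S.L c₁).map (f ≫ g ≫ h) ◁ (S.M b₄).mapComp f' (g' ≫ h') ⊗≫ 𝟙 _ := by
      rw [← hS.comp_L]; bicategory
    _ = _ := by
      rw [← whisker_exchange]; bicategory

theorem collate_leftUnitor (hS : S.IsDistLaw) {b₁ b₂ : B} (f : b₁ ⟶ b₂) {c₁ c₂ : C}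
    (g : c₁ ⟶ c₂) :
    S.collateMap₂ (λ_ f).inv (λ_ g).inv =
      (λ_ _).inv ≫ S.collateId b₁ c₁ ▷ ((S.L c₁).map f ≫ (S.M b₂).map g) ≫
        S.collateComp (𝟙 b₁) f (𝟙 c₁) g := by
  dsimp only [collateComp, collateMap₂, collateId]
  symm
  calc
    _ = 𝟙 _ ⊗≫ (S.L c₁).mapId b₁ ▷ ((S.L c₁).map f ≫ (S.M b₂).map g) ⊗≫
        (S.L c₁).map (𝟙 b₁) ◁ ((S.M b₁).mapId c₁ ▷ (S.L c₁).map f ≫ S.σ f (𝟙 c₁)) ▷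
          (S.M b₂).map g ⊗≫
        (S.L c₁).mapComp (𝟙 b₁) f ▷ ((S.M b₂).map (𝟙 c₁) ≫ (S.M b₂).map g) ⊗≫
        (S.L c₁).map (𝟙 b₁ ≫ f) ◁ (S.M b₂).mapComp (𝟙 c₁) g ⊗≫ 𝟙 _ := by
      bicategory
    _ = 𝟙 _ ⊗≫ (S.L c₁).mapId b₁ ▷ ((S.L c₁).map f ≫ (S.M b₂).map g) ⊗≫
        (((S.L c₁).map (𝟙 b₁) ≫ (S.L c₁).map f) ◁ (S.M b₂).mapId c₁ ≫
          (S.L c₁).mapComp (𝟙 b₁) f ▷ (S.M b₂).map (𝟙 c₁)) ▷ (S.M b₂).map g ⊗≫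
        (S.L c₁).map (𝟙 b₁ ≫ f) ◁ (S.M b₂).mapComp (𝟙 c₁) g ⊗≫ 𝟙 _ := by
      rw [hS.unit_M]; bicategory
    _ = ((λ_ _).inv ≫ (S.L c₁).mapId b₁ ▷ (S.L c₁).map f ≫ (S.L c₁).mapComp (𝟙 b₁) f) ▷
          (S.M b₂).map g ≫
        (S.L c₁).map (𝟙 b₁ ≫ f) ◁ ((λ_ _).inv ≫ (S.M b₂).mapId c₁ ▷ (S.M b₂).map g ≫
          (S.M b₂).mapComp (𝟙 c₁) g) := by
      rw [whisker_exchange]; bicategory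
    _ = _ := by
      rw [LaxOn.map₂_leftUnitor, LaxOn.map₂_leftUnitor]

theorem collate_rightUnitor (hS : S.IsDistLaw) {b₁ b₂ : B} (f : b₁ ⟶ b₂) {c₁ c₂ : C}
    (g : c₁ ⟶ c₂) :
    S.collateMap₂ (ρ_ f).inv (ρ_ g).inv =
      (ρ_ _).inv ≫ ((S.L c₁).map f ≫ (S.M b₂).map g) ◁ S.collateId b₂ c₂ ≫
        S.collateComp f (𝟙 b₂) g (𝟙 c₂) := by
  dsimp only [collateComp, collateMap₂, collateId]
  symm
  calc
    _ = 𝟙 _ ⊗≫ (S.L c₁).map f ◁ (S.M b₂).map g ◁ (S.L c₂).mapId b₂ ⊗≫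
        (S.L c₁).map f ◁ (((S.M b₂).map g ≫ (S.L c₂).map (𝟙 b₂)) ◁ (S.M b₂).mapId c₂ ≫
          S.σ (𝟙 b₂) g ▷ (S.M b₂).map (𝟙 c₂)) ⊗≫
        (S.L c₁).mapComp f (𝟙 b₂) ▷ ((S.M b₂).map g ≫ (S.M b₂).map (𝟙 c₂)) ⊗≫
        (S.L c₁).map (f ≫ 𝟙 b₂) ◁ (S.M b₂).mapComp g (𝟙 c₂) ⊗≫ 𝟙 _ := by
      bicategory
    _ = 𝟙 _ ⊗≫ (S.L c₁).map f ◁ ((S.M b₂).map g ◁ (S.L c₂).mapId b₂ ≫ S.σ (𝟙 b₂) g) ⊗≫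
        (((S.L c₁).map f ≫ (S.L c₁).map (𝟙 b₂)) ◁ ((S.M b₂).map g ◁ (S.M b₂).mapId c₂) ≫
        (S.L c₁).mapComp f (𝟙 b₂) ▷ ((S.M b₂).map g ≫ (S.M b₂).map (𝟙 c₂))) ⊗≫
        (S.L c₁).map (f ≫ 𝟙 b₂) ◁ (S.M b₂).mapComp g (𝟙 c₂) ⊗≫ 𝟙 _ := by
      rw [whisker_exchange]; bicategory
    _ = ((ρ_ _).inv ≫ (S.L c₁).map f ◁ (S.L c₁).mapId b₂ ≫ (S.L c₁).mapComp f (𝟙 b₂)) ▷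
          (S.M b₂).map g ≫
        (S.L c₁).map (f ≫ 𝟙 b₂) ◁ ((ρ_ _).inv ≫ (S.M b₂).map g ◁ (S.M b₂).mapId c₂ ≫
          (S.M b₂).mapComp g (𝟙 c₂)) := by
      rw [whisker_exchange, hS.unit_L]; bicategory
    _ = _ := by
      rw [LaxOn.map₂_rightUnitor, LaxOn.map₂_rightUnitor]

end DistData

/-- The collated lax bifunctor of a distributive law. -/
def DistLaw.collate (S : DistLaw B C D) : (B × C) ⥤ᴸ D where
  obj x := S.obj x.1 x.2
  map {x y} f := (S.L x.2).map f.1 ≫ (S.M y.1).map f.2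
  map₂ η := S.collateMap₂ η.1 η.2
  map₂_id f := by simp [DistData.collateMap₂, LaxOn.map₂_id]
  map₂_comp η θ := S.collateMap₂_comp η.1 θ.1 η.2 θ.2
  mapId x := S.collateId x.1 x.2
  mapComp f g := S.collateComp f.1 g.1 f.2 g.2
  mapComp_naturality_left η g := DistData.collateComp_naturality_left S.law η.1 g.1 η.2 g.2
  mapComp_naturality_right f _ _ η := DistData.collateComp_naturality_right S.law f.1 η.1 f.2 η.2
  map₂_associator f g h := DistData.collate_associator S.law f.1 g.1 h.1 f.2 g.2 h.2
  map₂_leftUnitor f := DistData.collate_leftUnitor S.law f.1 f.2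
  map₂_rightUnitor f := DistData.collate_rightUnitor S.law f.1 f.2

/-- An oplax transformation `F ⟶ G` between lax functors with prescribed 1-morphism components
`app`. -/
structure OplaxOn (F G : B ⥤ᴸ D) (app : ∀ a, F.obj a ⟶ G.obj a) where
  naturality {a b : B} (f : a ⟶ b) : F.map f ≫ app b ⟶ app a ≫ G.map f
  naturality_naturality {a b : B} {f g : a ⟶ b} (η : f ⟶ g) :
    F.map₂ η ▷ app b ≫ naturality g = naturality f ≫ app a ◁ G.map₂ η
  naturality_id (a : B) :
    F.mapId a ▷ app a ≫ naturality (𝟙 a) =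
      (λ_ (app a)).hom ≫ (ρ_ (app a)).inv ≫ app a ◁ G.mapId a
  naturality_comp {a b c : B} (f : a ⟶ b) (g : b ⟶ c) :
    F.mapComp f g ▷ app c ≫ naturality (f ≫ g) =
      (α_ _ _ _).hom ≫ F.map f ◁ naturality g ≫ (α_ _ _ _).inv ≫ naturality f ▷ G.map g ≫
        (α_ _ _ _).hom ≫ app a ◁ G.mapComp f g

namespace OplaxOn

/-- The underlying oplax transformation. -/
@[simps]
def toOplax {F G : B ⥤ᴸ D} {app : ∀ a, F.obj a ⟶ G.obj a} (η : OplaxOn F G app) :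
    Lax.OplaxTrans F G where
  app := app
  naturality := η.naturality
  naturality_naturality := η.naturality_naturality
  naturality_id := η.naturality_id
  naturality_comp := η.naturality_comp

/-- Every oplax transformation is an oplax transformation on its own components. -/
def of {F G : B ⥤ᴸ D} (η : F ⟶ G) : OplaxOn F G η.app where
  naturality := η.naturality
  naturality_naturality := η.naturality_naturality
  naturality_id := η.naturality_id
  naturality_comp := η.naturality_comp

/-- The identity oplax transformation. -/
def id (F : B ⥤ᴸ D) : OplaxOn F F (fun a => 𝟙 (F.obj a)) :=
  OplaxOn.of (𝟙 F)

/-- Composition of oplax transformations. -/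
def comp {F G H : B ⥤ᴸ D} {p : ∀ a, F.obj a ⟶ G.obj a} {q : ∀ a, G.obj a ⟶ H.obj a}
    (η : OplaxOn F G p) (θ : OplaxOn G H q) : OplaxOn F H (fun a => p a ≫ q a) :=
  OplaxOn.of (Lax.OplaxTrans.vComp η.toOplax θ.toOplax)

theorem id_naturality (F : B ⥤ᴸ D) {a b : B} (f : a ⟶ b) :
    (OplaxOn.id F).naturality f = (ρ_ _).hom ≫ (λ_ _).inv := rfl

theorem comp_naturality {F G H : B ⥤ᴸ D} {p : ∀ a, F.obj a ⟶ G.obj a}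
    {q : ∀ a, G.obj a ⟶ H.obj a} (η : OplaxOn F G p) (θ : OplaxOn G H q) {a b : B} (f : a ⟶ b) :
    (η.comp θ).naturality f = (α_ _ _ _).inv ≫ η.naturality f ▷ q b ≫ (α_ _ _ _).hom ≫
      p a ◁ θ.naturality f ≫ (α_ _ _ _).inv := rfl

end OplaxOn

/-- A pair of families of oplax transformations `θB b : M_b ⟶ M'_b` and `θC c : L_c ⟶ L'_c` with
`(θB b) c = (θC c) b = app b c` on components. -/
structure DistHomData (S T : DistData B C D) where
  app (b : B) (c : C) : S.obj b c ⟶ T.obj b c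
  θB (b : B) : OplaxOn (S.M b).toLax (T.M b).toLax (app b)
  θC (c : C) : OplaxOn (S.L c).toLax (T.L c).toLax (fun b => app b c)

/-- The Yang–Baxter equation for a pair of families of oplax transformations. -/
def DistHomData.YangBaxter {S T : DistData B C D} (θ : DistHomData S T) : Prop :=
  ∀ ⦃b₁ b₂ : B⦄ (f : b₁ ⟶ b₂) ⦃c₁ c₂ : C⦄ (g : c₁ ⟶ c₂),
    (S.M b₁).map g ◁ (θ.θC c₂).naturality f ≫ (α_ ((S.M b₁).map g) (θ.app b₁ c₂) ((T.L c₂).map f)).inv ≫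
        (θ.θB b₁).naturality g ▷ (T.L c₂).map f ≫ (α_ _ _ _).hom ≫ θ.app b₁ c₁ ◁ T.σ f g =
      (α_ ((S.M b₁).map g) ((S.L c₂).map f) (θ.app b₂ c₂)).inv ≫ S.σ f g ▷ θ.app b₂ c₂ ≫ (α_ _ _ _).hom ≫
        (S.L c₁).map f ◁ (θ.θB b₂).naturality g ≫ (α_ ((S.L c₁).map f) (θ.app b₂ c₁) ((T.M b₂).map g)).inv ≫
          (θ.θC c₁).naturality f ▷ (T.M b₂).map g ≫ (α_ _ _ _).hom

/-- A morphism of distributive laws. -/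
structure DistHom (S T : DistLaw B C D) extends
    DistHomData S.toDistData T.toDistData where
  yangBaxter : toDistHomData.YangBaxter

/-- A 2-morphism between morphisms of distributive laws: a family of 2-morphisms `app b c`, which
for each `b` is a modification between the transformations indexed by `b`, and for each `c` a
modification between the transformations indexed by `c`. -/
@[ext]
structure DistHom₂ {S T : DistLaw B C D} (θ ζ : DistHom S T) where
  app (b : B) (c : C) : θ.app b c ⟶ ζ.app b c
  naturality_B (b : B) {c₁ c₂ : C} (g : c₁ ⟶ c₂) :
    (S.M b).map g ◁ app b c₂ ≫ (ζ.θB b).naturality g =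
      (θ.θB b).naturality g ≫ app b c₁ ▷ (T.M b).map g
  naturality_C (c : C) {b₁ b₂ : B} (f : b₁ ⟶ b₂) :
    (S.L c).map f ◁ app b₂ c ≫ (ζ.θC c).naturality f =
      (θ.θC c).naturality f ≫ app b₁ c ▷ (T.L c).map f

namespace DistHom

theorem yangBaxter_comp_aux {s₁₁ s₁₂ s₂₁ s₂₂ t₁₁ t₁₂ t₂₁ t₂₂ u₁₁ u₁₂ u₂₁ u₂₂ : D}
    {Ms₁ : s₁₁ ⟶ s₁₂} {Ms₂ : s₂₁ ⟶ s₂₂} {Ls₁ : s₁₁ ⟶ s₂₁} {Ls₂ : s₁₂ ⟶ s₂₂}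
    {Mt₁ : t₁₁ ⟶ t₁₂} {Mt₂ : t₂₁ ⟶ t₂₂} {Lt₁ : t₁₁ ⟶ t₂₁} {Lt₂ : t₁₂ ⟶ t₂₂}
    {Mu₁ : u₁₁ ⟶ u₁₂} {Mu₂ : u₂₁ ⟶ u₂₂} {Lu₁ : u₁₁ ⟶ u₂₁} {Lu₂ : u₁₂ ⟶ u₂₂}
    {p₁₁ : s₁₁ ⟶ t₁₁} {p₁₂ : s₁₂ ⟶ t₁₂} {p₂₁ : s₂₁ ⟶ t₂₁} {p₂₂ : s₂₂ ⟶ t₂₂}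
    {q₁₁ : t₁₁ ⟶ u₁₁} {q₁₂ : t₁₂ ⟶ u₁₂} {q₂₁ : t₂₁ ⟶ u₂₁} {q₂₂ : t₂₂ ⟶ u₂₂}
    {σs : Ms₁ ≫ Ls₂ ⟶ Ls₁ ≫ Ms₂} {σt : Mt₁ ≫ Lt₂ ⟶ Lt₁ ≫ Mt₂} {σu : Mu₁ ≫ Lu₂ ⟶ Lu₁ ≫ Mu₂}
    {x1 : Ms₁ ≫ p₁₂ ⟶ p₁₁ ≫ Mt₁} {x2 : Ms₂ ≫ p₂₂ ⟶ p₂₁ ≫ Mt₂}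
    {x3 : Ls₁ ≫ p₂₁ ⟶ p₁₁ ≫ Lt₁} {x4 : Ls₂ ≫ p₂₂ ⟶ p₁₂ ≫ Lt₂}
    {y1 : Mt₁ ≫ q₁₂ ⟶ q₁₁ ≫ Mu₁} {y2 : Mt₂ ≫ q₂₂ ⟶ q₂₁ ≫ Mu₂}
    {y3 : Lt₁ ≫ q₂₁ ⟶ q₁₁ ≫ Lu₁} {y4 : Lt₂ ≫ q₂₂ ⟶ q₁₂ ≫ Lu₂}
    (h1 : Ms₁ ◁ x4 ≫ (α_ _ _ _).inv ≫ x1 ▷ Lt₂ ≫ (α_ _ _ _).hom ≫ p₁₁ ◁ σt =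
      (α_ _ _ _).inv ≫ σs ▷ p₂₂ ≫ (α_ _ _ _).hom ≫ Ls₁ ◁ x2 ≫ (α_ _ _ _).inv ≫ x3 ▷ Mt₂ ≫
        (α_ _ _ _).hom)
    (h2 : Mt₁ ◁ y4 ≫ (α_ _ _ _).inv ≫ y1 ▷ Lu₂ ≫ (α_ _ _ _).hom ≫ q₁₁ ◁ σu =
      (α_ _ _ _).inv ≫ σt ▷ q₂₂ ≫ (α_ _ _ _).hom ≫ Lt₁ ◁ y2 ≫ (α_ _ _ _).inv ≫ y3 ▷ Mu₂ ≫
        (α_ _ _ _).hom) :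
    Ms₁ ◁ ((α_ _ _ _).inv ≫ x4 ▷ q₂₂ ≫ (α_ _ _ _).hom ≫ p₁₂ ◁ y4 ≫ (α_ _ _ _).inv) ≫
        (α_ _ _ _).inv ≫
        ((α_ _ _ _).inv ≫ x1 ▷ q₁₂ ≫ (α_ _ _ _).hom ≫ p₁₁ ◁ y1 ≫ (α_ _ _ _).inv) ▷ Lu₂ ≫
        (α_ _ _ _).hom ≫ (p₁₁ ≫ q₁₁) ◁ σu =
      (α_ _ _ _).inv ≫ σs ▷ (p₂₂ ≫ q₂₂) ≫ (α_ _ _ _).hom ≫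
        Ls₁ ◁ ((α_ _ _ _).inv ≫ x2 ▷ q₂₂ ≫ (α_ _ _ _).hom ≫ p₂₁ ◁ y2 ≫ (α_ _ _ _).inv) ≫
        (α_ _ _ _).inv ≫
        ((α_ _ _ _).inv ≫ x3 ▷ q₂₁ ≫ (α_ _ _ _).hom ≫ p₁₁ ◁ y3 ≫ (α_ _ _ _).inv) ▷ Mu₂ ≫
        (α_ _ _ _).hom := by
  calc
    _ = 𝟙 _ ⊗≫ Ms₁ ◁ x4 ▷ q₂₂ ⊗≫ ((Ms₁ ≫ p₁₂) ◁ y4 ≫ x1 ▷ (q₁₂ ≫ Lu₂)) ⊗≫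
        p₁₁ ◁ y1 ▷ Lu₂ ⊗≫ p₁₁ ◁ q₁₁ ◁ σu ⊗≫ 𝟙 _ := by
      bicategory
    _ = 𝟙 _ ⊗≫ Ms₁ ◁ x4 ▷ q₂₂ ⊗≫ x1 ▷ (Lt₂ ≫ q₂₂) ⊗≫
        p₁₁ ◁ (Mt₁ ◁ y4 ≫ (α_ _ _ _).inv ≫ y1 ▷ Lu₂ ≫ (α_ _ _ _).hom ≫ q₁₁ ◁ σu) ⊗≫ 𝟙 _ := by
      rw [whisker_exchange]; bicategory
    _ = 𝟙 _ ⊗≫ (Ms₁ ◁ x4 ≫ (α_ _ _ _).inv ≫ x1 ▷ Lt₂ ≫ (α_ _ _ _).hom ≫ p₁₁ ◁ σt) ▷ q₂₂ ⊗≫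
        p₁₁ ◁ Lt₁ ◁ y2 ⊗≫ p₁₁ ◁ y3 ▷ Mu₂ ⊗≫ 𝟙 _ := by
      rw [h2]; bicategory
    _ = 𝟙 _ ⊗≫ σs ▷ (p₂₂ ≫ q₂₂) ⊗≫ Ls₁ ◁ x2 ▷ q₂₂ ⊗≫
        (x3 ▷ (Mt₂ ≫ q₂₂) ≫ (p₁₁ ≫ Lt₁) ◁ y2) ⊗≫ p₁₁ ◁ y3 ▷ Mu₂ ⊗≫ 𝟙 _ := by
      rw [h1]; bicategory
    _ = _ := by
      rw [← whisker_exchange]; bicategory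

theorem comp_yangBaxter {S T U : DistData B C D} (θ : DistHomData S T) (ζ : DistHomData T U)
    (hθ : θ.YangBaxter) (hζ : ζ.YangBaxter) :
    DistHomData.YangBaxter (S := S) (T := U)
      { app := fun b c => θ.app b c ≫ ζ.app b c
        θB := fun b => (θ.θB b).comp (ζ.θB b)
        θC := fun c => (θ.θC c).comp (ζ.θC c) } :=
  fun _ _ f _ _ g => yangBaxter_comp_aux (hθ f g) (hζ f g)

theorem id_yangBaxter_aux {s₁₁ s₁₂ s₂₁ s₂₂ : D} {M₁ : s₁₁ ⟶ s₁₂} {M₂ : s₂₁ ⟶ s₂₂}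
    {L₁ : s₁₁ ⟶ s₂₁} {L₂ : s₁₂ ⟶ s₂₂} (σ : M₁ ≫ L₂ ⟶ L₁ ≫ M₂) :
    M₁ ◁ ((ρ_ L₂).hom ≫ (λ_ L₂).inv) ≫ (α_ _ _ _).inv ≫ ((ρ_ M₁).hom ≫ (λ_ M₁).inv) ▷ L₂ ≫
        (α_ _ _ _).hom ≫ 𝟙 _ ◁ σ =
      (α_ _ _ _).inv ≫ σ ▷ 𝟙 _ ≫ (α_ _ _ _).hom ≫ L₁ ◁ ((ρ_ M₂).hom ≫ (λ_ M₂).inv) ≫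
        (α_ _ _ _).inv ≫ ((ρ_ L₁).hom ≫ (λ_ L₁).inv) ▷ M₂ ≫ (α_ _ _ _).hom := by
  bicategory

/-- The identity morphism of distributive laws. -/
def id (S : DistLaw B C D) : DistHom S S where
  app b c := 𝟙 (S.obj b c)
  θB b := OplaxOn.id (S.M b).toLax
  θC c := OplaxOn.id (S.L c).toLax
  yangBaxter _ _ f _ _ g := id_yangBaxter_aux (S.σ f g)

/-- Composition of morphisms of distributive laws. -/
def comp {S T U : DistLaw B C D} (θ : DistHom S T) (ζ : DistHom T U) : DistHom S U where
  app b c := θ.app b c ≫ ζ.app b c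
  θB b := (θ.θB b).comp (ζ.θB b)
  θC c := (θ.θC c).comp (ζ.θC c)
  yangBaxter := comp_yangBaxter θ.toDistHomData ζ.toDistHomData θ.yangBaxter ζ.yangBaxter

end DistHom

@[simps]
instance DistLaw.categoryStruct : CategoryStruct (DistLaw B C D) where
  Hom := DistHom
  id := DistHom.id
  comp := DistHom.comp

namespace DistHom₂

variable {S T U : DistLaw B C D}

/-- The modification between the transformations indexed by `b`. -/
def modB {θ ζ : DistHom S T} (Γ : DistHom₂ θ ζ) (b : B) :
    @Quiver.Hom ((S.M b).toLax ⟶ (T.M b).toLax) _ (θ.θB b).toOplax (ζ.θB b).toOplax :=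
  ⟨⟨Γ.app b, Γ.naturality_B b⟩⟩

/-- The modification between the transformations indexed by `c`. -/
def modC {θ ζ : DistHom S T} (Γ : DistHom₂ θ ζ) (c : C) :
    @Quiver.Hom ((S.L c).toLax ⟶ (T.L c).toLax) _ (θ.θC c).toOplax (ζ.θC c).toOplax :=
  ⟨⟨fun b => Γ.app b c, Γ.naturality_C c⟩⟩

end DistHom₂

@[simps]
instance DistLaw.homCategory (S T : DistLaw B C D) : Category (S ⟶ T) where
  Hom θ ζ := DistHom₂ θ ζ
  id θ :=
    { app := fun b c => 𝟙 (θ.app b c)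
      naturality_B := fun b _ _ g =>
        (Lax.OplaxTrans.Modification.id (θ.θB b).toOplax).naturality g
      naturality_C := fun c _ _ f =>
        (Lax.OplaxTrans.Modification.id (θ.θC c).toOplax).naturality f }
  comp {θ ζ ξ} Γ Γ₁ :=
    { app := fun b c => Γ.app b c ≫ Γ₁.app b c
      naturality_B := fun b _ _ g => (Γ.modB b ≫ Γ₁.modB b).as.naturality g
      naturality_C := fun c _ _ f => (Γ.modC c ≫ Γ₁.modC c).as.naturality f }
  id_comp Γ := by apply DistHom₂.ext; funext b c; exact Category.id_comp _
  comp_id Γ := by apply DistHom₂.ext; funext b c; exact Category.comp_id _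
  assoc Γ₁ Γ₂ Γ₃ := by apply DistHom₂.ext; funext b c; exact Category.assoc _ _ _

theorem DistLaw.hom₂_ext {S T : DistLaw B C D} {θ ζ : S ⟶ T} {Γ₁ Γ₂ : θ ⟶ ζ}
    (h : ∀ b c, Γ₁.app b c = Γ₂.app b c) : Γ₁ = Γ₂ :=
  DistHom₂.ext (funext fun b => funext fun c => h b c)

theorem modification_inv_aux {a b a' b' : D} {M : a ⟶ b} {M' : a' ⟶ b'} {p q : a ⟶ a'}
    {p' q' : b ⟶ b'} (φ : p ≅ q) (φ' : p' ≅ q') {x : M ≫ p' ⟶ p ≫ M'} {y : M ≫ q' ⟶ q ≫ M'}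
    (h : M ◁ φ'.hom ≫ y = x ≫ φ.hom ▷ M') : M ◁ φ'.inv ≫ x = y ≫ φ.inv ▷ M' := by
  simpa using M ◁ φ'.inv ≫= h.symm =≫ φ.inv ▷ M'

/-- Invertible 2-morphisms of distributive laws are built from invertible components. -/
def DistHom₂.isoMk {S T : DistLaw B C D} {θ ζ : S ⟶ T} (φ : ∀ b c, θ.app b c ≅ ζ.app b c)
    (hB : ∀ (b : B) {c₁ c₂ : C} (g : c₁ ⟶ c₂), (S.M b).map g ◁ (φ b c₂).hom ≫ (ζ.θB b).naturality g =
      (θ.θB b).naturality g ≫ (φ b c₁).hom ▷ (T.M b).map g)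
    (hC : ∀ (c : C) {b₁ b₂ : B} (f : b₁ ⟶ b₂), (S.L c).map f ◁ (φ b₂ c).hom ≫ (ζ.θC c).naturality f =
      (θ.θC c).naturality f ≫ (φ b₁ c).hom ▷ (T.L c).map f) : θ ≅ ζ where
  hom := { app := fun b c => (φ b c).hom, naturality_B := hB, naturality_C := hC }
  inv :=
    { app := fun b c => (φ b c).inv
      naturality_B := fun b _ _ g => modification_inv_aux (φ b _) (φ b _) (hB b g)
      naturality_C := fun c _ _ f => modification_inv_aux (φ _ c) (φ _ c) (hC c f) }
  hom_inv_id := DistLaw.hom₂_ext fun b c => (φ b c).hom_inv_id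
  inv_hom_id := DistLaw.hom₂_ext fun b c => (φ b c).inv_hom_id

/-- Left whiskering of 2-morphisms of distributive laws. -/
def DistHom₂.whiskerLeft {S T U : DistLaw B C D} (θ : S ⟶ T) {ζ ξ : T ⟶ U} (Γ : ζ ⟶ ξ) :
    DistHom₂ (θ ≫ ζ) (θ ≫ ξ) where
  app b c := θ.app b c ◁ Γ.app b c
  naturality_B b _ _ g := (Lax.OplaxTrans.whiskerLeft
    (F := (S.M b).toLax) (θ.θB b).toOplax (Γ.modB b)).as.naturality g
  naturality_C c _ _ f := (Lax.OplaxTrans.whiskerLeft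
    (F := (S.L c).toLax) (θ.θC c).toOplax (Γ.modC c)).as.naturality f

/-- Right whiskering of 2-morphisms of distributive laws. -/
def DistHom₂.whiskerRight {S T U : DistLaw B C D} {θ ζ : S ⟶ T} (Γ : θ ⟶ ζ) (ξ : T ⟶ U) :
    DistHom₂ (θ ≫ ξ) (ζ ≫ ξ) where
  app b c := Γ.app b c ▷ ξ.app b c
  naturality_B b _ _ g := (Lax.OplaxTrans.whiskerRight
    (F := (S.M b).toLax) (Γ.modB b) (ξ.θB b).toOplax).as.naturality g
  naturality_C c _ _ f := (Lax.OplaxTrans.whiskerRight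
    (F := (S.L c).toLax) (Γ.modC c) (ξ.θC c).toOplax).as.naturality f

/-- The 2-category of distributive laws: morphisms are pairs of families of oplax transformations
satisfying the Yang–Baxter equation, 2-morphisms are families of modifications. Everything is
computed componentwise. -/
instance DistLaw.bicategory : Bicategory (DistLaw B C D) where
  whiskerLeft θ _ _ Γ := DistHom₂.whiskerLeft θ Γ
  whiskerRight Γ ξ := DistHom₂.whiskerRight Γ ξ
  associator {S T U V} θ ζ ξ := DistHom₂.isoMk (fun b c => α_ (θ.app b c) (ζ.app b c) (ξ.app b c))
    (fun b _ _ g => (Lax.OplaxTrans.associator (F := (S.M b).toLax) (θ.θB b).toOplax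
      (ζ.θB b).toOplax (ξ.θB b).toOplax).hom.as.naturality g)
    (fun c _ _ f => (Lax.OplaxTrans.associator (F := (S.L c).toLax) (θ.θC c).toOplax
      (ζ.θC c).toOplax (ξ.θC c).toOplax).hom.as.naturality f)
  leftUnitor {S T} θ := DistHom₂.isoMk (fun b c => λ_ (θ.app b c))
    (fun b _ _ g => (Lax.OplaxTrans.leftUnitor (F := (S.M b).toLax)
      (θ.θB b).toOplax).hom.as.naturality g)
    (fun c _ _ f => (Lax.OplaxTrans.leftUnitor (F := (S.L c).toLax)
      (θ.θC c).toOplax).hom.as.naturality f)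
  rightUnitor {S T} θ := DistHom₂.isoMk (fun b c => ρ_ (θ.app b c))
    (fun b _ _ g => (Lax.OplaxTrans.rightUnitor (F := (S.M b).toLax)
      (θ.θB b).toOplax).hom.as.naturality g)
    (fun c _ _ f => (Lax.OplaxTrans.rightUnitor (F := (S.L c).toLax)
      (θ.θC c).toOplax).hom.as.naturality f)
  whiskerLeft_id _ _ := DistLaw.hom₂_ext fun _ _ => Bicategory.whiskerLeft_id _ _
  whiskerLeft_comp _ _ _ _ _ _ := DistLaw.hom₂_ext fun _ _ => Bicategory.whiskerLeft_comp _ _ _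
  id_whiskerLeft _ := DistLaw.hom₂_ext fun _ _ => Bicategory.id_whiskerLeft _
  comp_whiskerLeft _ _ _ _ _ := DistLaw.hom₂_ext fun _ _ => Bicategory.comp_whiskerLeft _ _ _
  id_whiskerRight _ _ := DistLaw.hom₂_ext fun _ _ => Bicategory.id_whiskerRight _ _
  comp_whiskerRight _ _ _ := DistLaw.hom₂_ext fun _ _ => Bicategory.comp_whiskerRight _ _ _
  whiskerRight_id _ := DistLaw.hom₂_ext fun _ _ => Bicategory.whiskerRight_id _
  whiskerRight_comp _ _ _ := DistLaw.hom₂_ext fun _ _ => Bicategory.whiskerRight_comp _ _ _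
  whisker_assoc _ _ _ _ _ := DistLaw.hom₂_ext fun _ _ => Bicategory.whisker_assoc _ _ _
  whisker_exchange _ _ := DistLaw.hom₂_ext fun _ _ => Bicategory.whisker_exchange _ _
  pentagon _ _ _ _ := DistLaw.hom₂_ext fun _ _ => Bicategory.pentagon _ _ _ _
  triangle _ _ := DistLaw.hom₂_ext fun _ _ => Bicategory.triangle _ _

namespace DistHomData

/-- Pasting of two oplax naturality cells. -/
abbrev paste {a b c a' b' c' : D} {L : a ⟶ b} {M : b ⟶ c} {L' : a' ⟶ b'} {M' : b' ⟶ c'}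
    {p : a ⟶ a'} {q : b ⟶ b'} {r : c ⟶ c'} (y : L ≫ q ⟶ p ≫ L') (x : M ≫ r ⟶ q ≫ M') :
    (L ≫ M) ≫ r ⟶ p ≫ (L' ≫ M') :=
  (α_ _ _ _).hom ≫ L ◁ x ≫ (α_ _ _ _).inv ≫ y ▷ M' ≫ (α_ _ _ _).hom

theorem paste_naturality {a b c a' b' c' : D} {L₁ L₂ : a ⟶ b} {M₁ M₂ : b ⟶ c} {L₁' L₂' : a' ⟶ b'}
    {M₁' M₂' : b' ⟶ c'} {p : a ⟶ a'} {q : b ⟶ b'} {r : c ⟶ c'}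
    {y₁ : L₁ ≫ q ⟶ p ≫ L₁'} {x₁ : M₁ ≫ r ⟶ q ≫ M₁'}
    {y₂ : L₂ ≫ q ⟶ p ≫ L₂'} {x₂ : M₂ ≫ r ⟶ q ≫ M₂'}
    {α : L₁ ⟶ L₂} {β : M₁ ⟶ M₂} {α' : L₁' ⟶ L₂'} {β' : M₁' ⟶ M₂'}
    (hy : α ▷ q ≫ y₂ = y₁ ≫ p ◁ α') (hx : β ▷ r ≫ x₂ = x₁ ≫ q ◁ β') :
    (α ▷ M₁ ≫ L₂ ◁ β) ▷ r ≫ paste y₂ x₂ = paste y₁ x₁ ≫ p ◁ (α' ▷ M₁' ≫ L₂' ◁ β') := by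
  dsimp only [paste]
  calc
    _ = 𝟙 _ ⊗≫ α ▷ (M₁ ≫ r) ⊗≫ L₂ ◁ (β ▷ r ≫ x₂) ⊗≫ y₂ ▷ M₂' ⊗≫ 𝟙 _ := by
      bicategory
    _ = 𝟙 _ ⊗≫ (α ▷ (M₁ ≫ r) ≫ L₂ ◁ x₁) ⊗≫ ((L₂ ≫ q) ◁ β' ≫ y₂ ▷ M₂') ⊗≫ 𝟙 _ := by
      rw [hx]; bicategory
    _ = 𝟙 _ ⊗≫ L₁ ◁ x₁ ⊗≫ (α ▷ q ≫ y₂) ▷ M₁' ⊗≫ p ◁ L₂' ◁ β' ⊗≫ 𝟙 _ := by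
      rw [← whisker_exchange, whisker_exchange y₂]; bicategory
    _ = _ := by
      rw [hy]; bicategory

theorem paste_id {a a' : D} {L M : a ⟶ a} {L' M' : a' ⟶ a'} {p : a ⟶ a'}
    {y : L ≫ p ⟶ p ≫ L'} {x : M ≫ p ⟶ p ≫ M'} {i : 𝟙 a ⟶ L} {j : 𝟙 a ⟶ M}
    {i' : 𝟙 a' ⟶ L'} {j' : 𝟙 a' ⟶ M'}
    (hy : i ▷ p ≫ y = (λ_ p).hom ≫ (ρ_ p).inv ≫ p ◁ i')
    (hx : j ▷ p ≫ x = (λ_ p).hom ≫ (ρ_ p).inv ≫ p ◁ j') :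
    ((λ_ _).inv ≫ i ▷ 𝟙 a ≫ L ◁ j) ▷ p ≫ paste y x =
      (λ_ p).hom ≫ (ρ_ p).inv ≫ p ◁ ((λ_ _).inv ≫ i' ▷ 𝟙 a' ≫ L' ◁ j') := by
  dsimp only [paste]
  calc
    _ = 𝟙 _ ⊗≫ i ▷ p ⊗≫ L ◁ (j ▷ p ≫ x) ⊗≫ y ▷ M' ⊗≫ 𝟙 _ := by
      bicategory
    _ = 𝟙 _ ⊗≫ i ▷ p ⊗≫ ((L ≫ p) ◁ j' ≫ y ▷ M') ⊗≫ 𝟙 _ := by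
      rw [hx]; bicategory
    _ = 𝟙 _ ⊗≫ (i ▷ p ≫ y) ⊗≫ p ◁ L' ◁ j' ⊗≫ 𝟙 _ := by
      rw [whisker_exchange]; bicategory
    _ = _ := by
      rw [hy]; bicategory

/- Objects are indexed by positions: `s₁₁ ⟶ s₂₁ ⟶ s₂₂ ⟶ s₃₂ ⟶ s₃₃`, and the braiding goes through
`s₃₂` and `s₂₂`. -/
theorem paste_comp {s₁₁ s₂₁ s₂₂ s₃₁ s₃₂ s₃₃ t₁₁ t₂₁ t₂₂ t₃₁ t₃₂ t₃₃ : D}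
    {La : s₁₁ ⟶ s₂₁} {Ma : s₂₁ ⟶ s₂₂} {Lb : s₂₂ ⟶ s₃₂} {Mb : s₃₂ ⟶ s₃₃}
    {Lc : s₂₁ ⟶ s₃₁} {Mc : s₃₁ ⟶ s₃₂} {Ld : s₁₁ ⟶ s₃₁} {Md : s₃₁ ⟶ s₃₃}
    {La' : t₁₁ ⟶ t₂₁} {Ma' : t₂₁ ⟶ t₂₂} {Lb' : t₂₂ ⟶ t₃₂} {Mb' : t₃₂ ⟶ t₃₃}
    {Lc' : t₂₁ ⟶ t₃₁} {Mc' : t₃₁ ⟶ t₃₂} {Ld' : t₁₁ ⟶ t₃₁} {Md' : t₃₁ ⟶ t₃₃}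
    {p₁₁ : s₁₁ ⟶ t₁₁} {p₂₁ : s₂₁ ⟶ t₂₁} {p₂₂ : s₂₂ ⟶ t₂₂} {p₃₁ : s₃₁ ⟶ t₃₁} {p₃₂ : s₃₂ ⟶ t₃₂}
    {p₃₃ : s₃₃ ⟶ t₃₃}
    {la : La ≫ p₂₁ ⟶ p₁₁ ≫ La'} {ma : Ma ≫ p₂₂ ⟶ p₂₁ ≫ Ma'}
    {lb : Lb ≫ p₃₂ ⟶ p₂₂ ≫ Lb'} {mb : Mb ≫ p₃₃ ⟶ p₃₂ ≫ Mb'}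
    {lc : Lc ≫ p₃₁ ⟶ p₂₁ ≫ Lc'} {mc : Mc ≫ p₃₂ ⟶ p₃₁ ≫ Mc'}
    {ld : Ld ≫ p₃₁ ⟶ p₁₁ ≫ Ld'} {md : Md ≫ p₃₃ ⟶ p₃₁ ≫ Md'}
    {σ : Ma ≫ Lb ⟶ Lc ≫ Mc} {σ' : Ma' ≫ Lb' ⟶ Lc' ≫ Mc'}
    {cL : La ≫ Lc ⟶ Ld} {cL' : La' ≫ Lc' ⟶ Ld'} {cM : Mc ≫ Mb ⟶ Md} {cM' : Mc' ≫ Mb' ⟶ Md'}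
    (hL : cL ▷ p₃₁ ≫ ld = (α_ _ _ _).hom ≫ La ◁ lc ≫ (α_ _ _ _).inv ≫ la ▷ Lc' ≫
      (α_ _ _ _).hom ≫ p₁₁ ◁ cL')
    (hM : cM ▷ p₃₃ ≫ md = (α_ _ _ _).hom ≫ Mc ◁ mb ≫ (α_ _ _ _).inv ≫ mc ▷ Mb' ≫
      (α_ _ _ _).hom ≫ p₃₁ ◁ cM')
    (hσ : Ma ◁ lb ≫ (α_ _ _ _).inv ≫ ma ▷ Lb' ≫ (α_ _ _ _).hom ≫ p₂₁ ◁ σ' =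
      (α_ _ _ _).inv ≫ σ ▷ p₃₂ ≫ (α_ _ _ _).hom ≫ Lc ◁ mc ≫ (α_ _ _ _).inv ≫ lc ▷ Mc' ≫
        (α_ _ _ _).hom) :
    ((α_ _ _ _).hom ≫ La ◁ ((α_ _ _ _).inv ≫ σ ▷ Mb ≫ (α_ _ _ _).hom) ≫ (α_ _ _ _).inv ≫
        cL ▷ (Mc ≫ Mb) ≫ Ld ◁ cM) ▷ p₃₃ ≫ paste ld md =
      (α_ _ _ _).hom ≫ (La ≫ Ma) ◁ paste lb mb ≫ (α_ _ _ _).inv ≫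
        paste la ma ▷ (Lb' ≫ Mb') ≫ (α_ _ _ _).hom ≫
        p₁₁ ◁ ((α_ _ _ _).hom ≫ La' ◁ ((α_ _ _ _).inv ≫ σ' ▷ Mb' ≫ (α_ _ _ _).hom) ≫
          (α_ _ _ _).inv ≫ cL' ▷ (Mc' ≫ Mb') ≫ Ld' ◁ cM') := by
  dsimp only [paste]
  calc
    _ = 𝟙 _ ⊗≫ La ◁ σ ▷ Mb ▷ p₃₃ ⊗≫ cL ▷ (Mc ≫ Mb ≫ p₃₃) ⊗≫
        Ld ◁ (cM ▷ p₃₃ ≫ md) ⊗≫ ld ▷ Md' ⊗≫ 𝟙 _ := by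
      bicategory
    _ = 𝟙 _ ⊗≫ La ◁ σ ▷ Mb ▷ p₃₃ ⊗≫ (cL ▷ (Mc ≫ Mb ≫ p₃₃) ≫
        Ld ◁ (Mc ◁ mb ≫ (α_ _ _ _).inv ≫ mc ▷ Mb' ≫ (α_ _ _ _).hom)) ⊗≫
        ((Ld ≫ p₃₁) ◁ cM' ≫ ld ▷ Md') ⊗≫ 𝟙 _ := by
      rw [hM]; bicategory
    _ = 𝟙 _ ⊗≫ La ◁ (σ ▷ (Mb ≫ p₃₃) ≫ (Lc ≫ Mc) ◁ mb) ⊗≫ La ◁ Lc ◁ mc ▷ Mb' ⊗≫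
        (cL ▷ p₃₁ ≫ ld) ▷ (Mc' ≫ Mb') ⊗≫ p₁₁ ◁ Ld' ◁ cM' ⊗≫ 𝟙 _ := by
      rw [← whisker_exchange, whisker_exchange ld]; bicategory
    _ = 𝟙 _ ⊗≫ La ◁ Ma ◁ Lb ◁ mb ⊗≫ La ◁ ((α_ _ _ _).inv ≫ σ ▷ p₃₂ ≫ (α_ _ _ _).hom ≫
          Lc ◁ mc ≫ (α_ _ _ _).inv ≫ lc ▷ Mc' ≫ (α_ _ _ _).hom) ▷ Mb' ⊗≫
        la ▷ (Lc' ≫ Mc' ≫ Mb') ⊗≫ p₁₁ ◁ cL' ▷ (Mc' ≫ Mb') ⊗≫ p₁₁ ◁ Ld' ◁ cM' ⊗≫ 𝟙 _ := by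
      rw [hL, ← whisker_exchange]; bicategory
    _ = 𝟙 _ ⊗≫ La ◁ Ma ◁ Lb ◁ mb ⊗≫ La ◁ Ma ◁ lb ▷ Mb' ⊗≫ La ◁ ma ▷ (Lb' ≫ Mb') ⊗≫
        ((La ≫ p₂₁) ◁ (σ' ▷ Mb') ≫ la ▷ ((Lc' ≫ Mc') ≫ Mb')) ⊗≫
        p₁₁ ◁ cL' ▷ (Mc' ≫ Mb') ⊗≫ p₁₁ ◁ Ld' ◁ cM' ⊗≫ 𝟙 _ := by
      rw [← hσ]; bicategory
    _ = _ := by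
      rw [whisker_exchange]; bicategory

end DistHomData

/-- Collation of a morphism of distributive laws to an oplax transformation. -/
def DistHom.collate {S T : DistLaw B C D} (θ : S ⟶ T) : S.collate ⟶ T.collate where
  app x := θ.app x.1 x.2
  naturality {x y} f := DistHomData.paste ((θ.θC x.2).naturality f.1) ((θ.θB y.1).naturality f.2)
  naturality_naturality {x y _ _} η := DistHomData.paste_naturality
    ((θ.θC x.2).naturality_naturality η.1) ((θ.θB y.1).naturality_naturality η.2)
  naturality_id x := DistHomData.paste_id ((θ.θC x.2).naturality_id x.1)
    ((θ.θB x.1).naturality_id x.2)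
  naturality_comp {x _ z} f g := DistHomData.paste_comp
    ((θ.θC x.2).naturality_comp f.1 g.1) ((θ.θB z.1).naturality_comp f.2 g.2)
    (θ.yangBaxter g.1 f.2)

namespace DistHomData

theorem paste_modification {a b c a' b' c' : D} {L : a ⟶ b} {M : b ⟶ c} {L' : a' ⟶ b'}
    {M' : b' ⟶ c'} {p₁ p₂ : a ⟶ a'} {q₁ q₂ : b ⟶ b'} {r₁ r₂ : c ⟶ c'}
    {y₁ : L ≫ q₁ ⟶ p₁ ≫ L'} {x₁ : M ≫ r₁ ⟶ q₁ ≫ M'}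
    {y₂ : L ≫ q₂ ⟶ p₂ ≫ L'} {x₂ : M ≫ r₂ ⟶ q₂ ≫ M'}
    {m : p₁ ⟶ p₂} {n : q₁ ⟶ q₂} {k : r₁ ⟶ r₂}
    (hy : L ◁ n ≫ y₂ = y₁ ≫ m ▷ L') (hx : M ◁ k ≫ x₂ = x₁ ≫ n ▷ M') :
    (L ≫ M) ◁ k ≫ paste y₂ x₂ = paste y₁ x₁ ≫ m ▷ (L' ≫ M') := by
  dsimp only [paste]
  calc
    _ = 𝟙 _ ⊗≫ L ◁ (M ◁ k ≫ x₂) ⊗≫ y₂ ▷ M' ⊗≫ 𝟙 _ := by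
      bicategory
    _ = 𝟙 _ ⊗≫ L ◁ x₁ ⊗≫ (L ◁ n ≫ y₂) ▷ M' ⊗≫ 𝟙 _ := by
      rw [hx]; bicategory
    _ = _ := by
      rw [hy]; bicategory

theorem paste_paste {a b c a' b' c' a'' b'' c'' : D} {L : a ⟶ b} {M : b ⟶ c} {L' : a' ⟶ b'}
    {M' : b' ⟶ c'} {L'' : a'' ⟶ b''} {M'' : b'' ⟶ c''} {p : a ⟶ a'} {q : b ⟶ b'} {r : c ⟶ c'}
    {p' : a' ⟶ a''} {q' : b' ⟶ b''} {r' : c' ⟶ c''}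
    (y : L ≫ q ⟶ p ≫ L') (x : M ≫ r ⟶ q ≫ M') (y' : L' ≫ q' ⟶ p' ≫ L'')
    (x' : M' ≫ r' ⟶ q' ≫ M'') :
    paste ((α_ _ _ _).inv ≫ y ▷ q' ≫ (α_ _ _ _).hom ≫ p ◁ y' ≫ (α_ _ _ _).inv)
        ((α_ _ _ _).inv ≫ x ▷ r' ≫ (α_ _ _ _).hom ≫ q ◁ x' ≫ (α_ _ _ _).inv) =
      (α_ _ _ _).inv ≫ paste y x ▷ r' ≫ (α_ _ _ _).hom ≫ p ◁ paste y' x' ≫ (α_ _ _ _).inv := by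
  dsimp only [paste]
  calc
    _ = 𝟙 _ ⊗≫ L ◁ x ▷ r' ⊗≫ ((L ≫ q) ◁ x' ≫ y ▷ (q' ≫ M'')) ⊗≫ p ◁ y' ▷ M'' ⊗≫ 𝟙 _ := by
      bicategory
    _ = _ := by
      rw [whisker_exchange]; bicategory

theorem paste_unit {a b c : D} (L : a ⟶ b) (M : b ⟶ c) :
    paste ((ρ_ L).hom ≫ (λ_ L).inv) ((ρ_ M).hom ≫ (λ_ M).inv) =
      (ρ_ (L ≫ M)).hom ≫ (λ_ (L ≫ M)).inv := by
  dsimp only [paste]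
  bicategory

end DistHomData

/-- Collation of a 2-morphism of distributive laws to a modification. -/
def DistHom₂.collate {S T : DistLaw B C D} {θ ζ : S ⟶ T} (Γ : θ ⟶ ζ) :
    DistHom.collate θ ⟶ DistHom.collate ζ :=
  ⟨{ app := fun x => Γ.app x.1 x.2
     naturality := fun {x y} f => DistHomData.paste_modification
      (Γ.naturality_C x.2 f.1) (Γ.naturality_B y.1 f.2) }⟩

/-- Two oplax transformations with the same 1-morphism components and the same 2-morphism components
are equal. -/
theorem OplaxOn.toOplax_injective {F G : B ⥤ᴸ D} {app : ∀ a, F.obj a ⟶ G.obj a}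
    {η θ : OplaxOn F G app} (h : ∀ {a b : B} (f : a ⟶ b), η.naturality f = θ.naturality f) :
    η = θ := by
  cases η; cases θ
  congr
  funext a b f
  exact h f

theorem DistHom.collate_id (S : DistLaw B C D) : DistHom.collate (𝟙 S) = 𝟙 S.collate :=
  congrArg OplaxOn.toOplax (OplaxOn.toOplax_injective (app := fun x => 𝟙 (S.collate.obj x))
    (η := OplaxOn.of (DistHom.collate (𝟙 S))) (θ := OplaxOn.of (𝟙 S.collate))
    (fun _ => DistHomData.paste_unit _ _))

theorem DistHom.collate_comp {S T U : DistLaw B C D} (θ : S ⟶ T) (ζ : T ⟶ U) :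
    DistHom.collate (θ ≫ ζ) = DistHom.collate θ ≫ DistHom.collate ζ :=
  congrArg OplaxOn.toOplax (OplaxOn.toOplax_injective
    (η := OplaxOn.of (DistHom.collate (θ ≫ ζ)))
    (θ := OplaxOn.of (DistHom.collate θ ≫ DistHom.collate ζ))
    (fun _ => DistHomData.paste_paste _ _ _ _))

/-- A lax functor is a pseudofunctor if all its unitors and compositors are invertible. -/
class LaxFunctor.IsPseudo (F : B ⥤ᴸ D) : Prop where
  isIso_mapId (a : B) : IsIso (F.mapId a)
  isIso_mapComp {a b c : B} (f : a ⟶ b) (g : b ⟶ c) : IsIso (F.mapComp f g)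

attribute [instance] LaxFunctor.IsPseudo.isIso_mapId LaxFunctor.IsPseudo.isIso_mapComp

/-- A 1-morphism which is an isomorphism (has a strict two-sided inverse). -/
def IsIsoOneCell {X : Type*} [CategoryStruct X] {a b : X} (f : a ⟶ b) : Prop :=
  ∃ g : b ⟶ a, f ≫ g = 𝟙 a ∧ g ≫ f = 𝟙 b

/-- A pseudonatural isomorphism: an oplax transformation with invertible 2-morphism components,
having a strict two-sided inverse. -/
def IsPseudonaturalIso {F G : B ⥤ᴸ D} (η : F ⟶ G) : Prop :=
  (∀ ⦃a b : B⦄ (f : a ⟶ b), IsIso (η.naturality f)) ∧ IsIsoOneCell η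

/-- `η` has identity 1-morphism components and 2-morphism components `cell`. -/
def HasComponents {ob : B → D} {F G : LaxOn ob}
    (cell : ∀ {a b : B} (f : a ⟶ b), F.map f ≫ 𝟙 (ob b) ⟶ 𝟙 (ob a) ≫ G.map f)
    (η : F.toLax ⟶ G.toLax) : Prop :=
  ∃ κ : OplaxOn F.toLax G.toLax (fun a => 𝟙 (ob a)),
    (∀ ⦃a b : B⦄ (f : a ⟶ b), κ.naturality f = cell f) ∧ η = κ.toOplax

/-! ### Restrictions of a lax bifunctor -/

namespace LaxFunctor

/-- The restriction `P(b, -)` of a lax bifunctor. -/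
def fixLeft (P : (B × C) ⥤ᴸ D) (b : B) : C ⥤ᴸ D :=
  (Bicategory.Prod.sectR b C).toPseudofunctor.toLax.comp P

/-- The restriction `P(-, c)` of a lax bifunctor. -/
def fixRight (P : (B × C) ⥤ᴸ D) (c : C) : B ⥤ᴸ D :=
  (Bicategory.Prod.sectL B c).toPseudofunctor.toLax.comp P

/-- `P(b, -)` as a lax functor on the object function `c ↦ P(b, c)`. -/
def fixLeftOn (P : (B × C) ⥤ᴸ D) (b : B) : LaxOn (fun c => P.obj (b, c)) :=
  LaxOn.of (P.fixLeft b)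

/-- `P(-, c)` as a lax functor on the object function `b ↦ P(b, c)`. -/
def fixRightOn (P : (B × C) ⥤ᴸ D) (c : C) : LaxOn (fun b => P.obj (b, c)) :=
  LaxOn.of (P.fixRight c)

/-- The 1-morphism `(f, 𝟙)` of `B × C`. -/
abbrev inL {b₁ b₂ : B} (f : b₁ ⟶ b₂) (c : C) : (b₁, c) ⟶ (b₂, c) := (f, 𝟙 c)

/-- The 1-morphism `(𝟙, g)` of `B × C`. -/
abbrev inR (b : B) {c₁ c₂ : C} (g : c₁ ⟶ c₂) : (b, c₁) ⟶ (b, c₂) := (𝟙 b, g)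

/-- The canonical 2-isomorphism `(𝟙 ≫ f, g ≫ 𝟙) ⟶ (f ≫ 𝟙, 𝟙 ≫ g)` of `B × C`. It is given by unitors,
hence is an identity if `B` and `C` are strict. -/
abbrev interchange {b₁ b₂ : B} (f : b₁ ⟶ b₂) {c₁ c₂ : C} (g : c₁ ⟶ c₂) :
    inR b₁ g ≫ inL f c₂ ⟶ inL f c₁ ≫ inR b₂ g :=
  ((λ_ f).hom ≫ (ρ_ f).inv, (ρ_ g).hom ≫ (λ_ g).inv)

/-- The canonical 2-isomorphism `(f ≫ 𝟙, 𝟙 ≫ g) ⟶ (f, g)` of `B × C`. It is given by unitors,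
hence is an identity if `B` and `C` are strict. -/
abbrev factor {x y : B × C} (f : x ⟶ y) : inL f.1 x.2 ≫ inR y.1 f.2 ⟶ f :=
  ((ρ_ f.1).hom, (λ_ f.2).hom)

/-- The 2-morphism `P(f, 𝟙) ∘ P(𝟙, g) ⟶ P(𝟙, g) ∘ P(f, 𝟙)` given by the compositor of `(𝟙, g)` and
`(f, 𝟙)` followed by the inverse of the compositor of `(f, 𝟙)` and `(𝟙, g)`. -/
noncomputable def restrictσ (P : (B × C) ⥤ᴸ D) [P.IsPseudo] {b₁ b₂ : B} (f : b₁ ⟶ b₂) {c₁ c₂ : C}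
    (g : c₁ ⟶ c₂) :
    P.map (inR b₁ g) ≫ P.map (inL f c₂) ⟶ P.map (inL f c₁) ≫ P.map (inR b₂ g) :=
  P.mapComp (inR b₁ g) (inL f c₂) ≫ P.map₂ (interchange f g) ≫
    inv (P.mapComp (inL f c₁) (inR b₂ g))

/-- The families `P(b, -)` and `P(-, c)` of restrictions of a pseudo-bifunctor, with the 2-morphisms
`restrictσ`. -/
noncomputable def restrictData (P : (B × C) ⥤ᴸ D) [P.IsPseudo] : DistData B C D where
  obj b c := P.obj (b, c)
  M b := P.fixLeftOn b
  L c := P.fixRightOn c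
  σ f _ _ g := P.restrictσ f g

end LaxFunctor

theorem precomp_aux₁ {a b : D} {p : a ⟶ b} {F₁ F₂ : a ⟶ a} {G₁ G₂ : b ⟶ b} {i : 𝟙 a ⟶ F₁}
    {i' : 𝟙 b ⟶ G₁} {α : F₁ ⟶ F₂} {β : G₁ ⟶ G₂} {x : F₁ ≫ p ⟶ p ≫ G₁} {y : F₂ ≫ p ⟶ p ≫ G₂}
    (h₁ : i ▷ p ≫ x = (λ_ p).hom ≫ (ρ_ p).inv ≫ p ◁ i') (h₂ : α ▷ p ≫ y = x ≫ p ◁ β) :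
    (i ≫ α) ▷ p ≫ y = (λ_ p).hom ≫ (ρ_ p).inv ≫ p ◁ (i' ≫ β) := by
  rw [comp_whiskerRight, Category.assoc, h₂, reassoc_of% h₁, Bicategory.whiskerLeft_comp]

theorem precomp_aux₂ {a a' b b' c c' : D} {p : a ⟶ a'} {q : b ⟶ b'} {r : c ⟶ c'} {F : a ⟶ b}
    {F' : b ⟶ c} {G : a' ⟶ b'} {G' : b' ⟶ c'} {F₁ F₂ : a ⟶ c} {G₁ G₂ : a' ⟶ c'} {i : F ≫ F' ⟶ F₁}
    {i' : G ≫ G' ⟶ G₁} {α : F₁ ⟶ F₂} {β : G₁ ⟶ G₂} {x : F₁ ≫ r ⟶ p ≫ G₁} {y : F₂ ≫ r ⟶ p ≫ G₂}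
    {m : F ≫ q ⟶ p ≫ G} {n : F' ≫ r ⟶ q ≫ G'}
    (h₁ : i ▷ r ≫ x = (α_ _ _ _).hom ≫ F ◁ n ≫ (α_ _ _ _).inv ≫ m ▷ G' ≫
      (α_ _ _ _).hom ≫ p ◁ i') (h₂ : α ▷ r ≫ y = x ≫ p ◁ β) :
    (i ≫ α) ▷ r ≫ y = (α_ _ _ _).hom ≫ F ◁ n ≫ (α_ _ _ _).inv ≫ m ▷ G' ≫
      (α_ _ _ _).hom ≫ p ◁ (i' ≫ β) := by
  rw [comp_whiskerRight, Category.assoc, h₂, reassoc_of% h₁, Bicategory.whiskerLeft_comp]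

/-- Restriction of an oplax transformation along a lax functor. -/
def oplaxPrecomp {A : Type*} [Bicategory A] (H : A ⥤ᴸ B) {F G : B ⥤ᴸ D} (θ : F ⟶ G) :
    H.comp F ⟶ H.comp G where
  app a := θ.app (H.obj a)
  naturality f := θ.naturality (H.map f)
  naturality_naturality η := θ.naturality_naturality (H.map₂ η)
  naturality_id a := precomp_aux₁ (θ.naturality_id (H.obj a)) (θ.naturality_naturality (H.mapId a))
  naturality_comp f g := precomp_aux₂ (θ.naturality_comp (H.map f) (H.map g))
    (θ.naturality_naturality (H.mapComp f g))

/-- The restrictions `θ(b, -)` and `θ(-, c)` of an oplax transformation of pseudo-bifunctors. -/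
noncomputable def restrictHomData {P Q : (B × C) ⥤ᴸ D} [P.IsPseudo] [Q.IsPseudo] (θ : P ⟶ Q) :
    DistHomData P.restrictData Q.restrictData where
  app b c := θ.app (b, c)
  θB b := OplaxOn.of (oplaxPrecomp (Bicategory.Prod.sectR b C).toPseudofunctor.toLax θ)
  θC c := OplaxOn.of (oplaxPrecomp (Bicategory.Prod.sectL B c).toPseudofunctor.toLax θ)

/-! ### The 2-categories of invertible distributive laws and of pseudo-bifunctors -/

/-- All the lax functors `M b` and `L c` are pseudofunctors and all `σ f g` are invertible. -/
structure DistData.IsInvertible (S : DistData B C D) : Prop where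
  pseudo_M (b : B) : (S.M b).toLax.IsPseudo
  pseudo_L (c : C) : (S.L c).toLax.IsPseudo
  isIso_σ {b₁ b₂ : B} (f : b₁ ⟶ b₂) {c₁ c₂ : C} (g : c₁ ⟶ c₂) : IsIso (S.σ f g)

variable (B C D) in
/-- Invertible distributive laws of pseudofunctors. -/
structure InvDistLaw extends DistLaw B C D where
  invertible : toDistData.IsInvertible

variable (B C D) in
/-- The full sub-2-category of the 2-category of distributive laws on the invertible distributive
laws of pseudofunctors. -/
abbrev InvDist := InducedBicategory (DistLaw B C D) (InvDistLaw.toDistLaw (B := B) (C := C) (D := D))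

variable (B C D) in
/-- Pseudo-bifunctors. -/
structure PseudoBifunctor where
  toLax : (B × C) ⥤ᴸ D
  pseudo : toLax.IsPseudo

attribute [instance] PseudoBifunctor.pseudo

variable (B C D) in
/-- The full sub-2-category of pseudo-bifunctors in the 2-category of lax functors `B × C ⥤ᴸ D`,
oplax transformations and modifications. -/
abbrev PseudoBifun := InducedBicategory ((B × C) ⥤ᴸ D) (PseudoBifunctor.toLax (B := B) (C := C) (D := D))

/-! ### Collation and restriction as strict 2-functors -/

theorem PseudoBifun.hom₂_eq {P Q : PseudoBifun B C D} {η η' θ θ' : P ⟶ Q} (h : η = η')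
    (h' : θ' = θ) (Γ : η' ⟶ θ') {Φ : η ⟶ θ}
    (hΦ : ∀ x, HEq (Φ.hom.as.app x) (Γ.hom.as.app x)) : Φ = eqToHom h ≫ Γ ≫ eqToHom h' := by
  subst h h'
  rw [eqToHom_refl, eqToHom_refl, Category.id_comp, Category.comp_id]
  exact InducedBicategory.hom₂_ext (Lax.OplaxTrans.homCategory.ext fun x => eq_of_heq (hΦ x))

theorem PseudoBifun.hom₂_eq' {P Q : PseudoBifun B C D} {η η' θ : P ⟶ Q} (h : η = η')
    (Γ : η' ⟶ θ) {Φ : η ⟶ θ}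
    (hΦ : ∀ x, HEq (Φ.hom.as.app x) (Γ.hom.as.app x)) : Φ = eqToHom h ≫ Γ := by
  rw [PseudoBifun.hom₂_eq h rfl Γ hΦ, eqToHom_refl, Category.comp_id]

theorem InvDist.hom₂_eq {S T : InvDist B C D} {η η' θ θ' : S ⟶ T} (h : η = η')
    (h' : θ' = θ) (Γ : η' ⟶ θ') {Φ : η ⟶ θ}
    (hΦ : ∀ b c, HEq (Φ.hom.app b c) (Γ.hom.app b c)) : Φ = eqToHom h ≫ Γ ≫ eqToHom h' := by
  subst h h'
  rw [eqToHom_refl, eqToHom_refl, Category.id_comp, Category.comp_id]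
  exact InducedBicategory.hom₂_ext (DistLaw.hom₂_ext fun b c => eq_of_heq (hΦ b c))

theorem InvDist.hom₂_eq' {S T : InvDist B C D} {η η' θ : S ⟶ T} (h : η = η')
    (Γ : η' ⟶ θ) {Φ : η ⟶ θ}
    (hΦ : ∀ b c, HEq (Φ.hom.app b c) (Γ.hom.app b c)) : Φ = eqToHom h ≫ Γ := by
  rw [InvDist.hom₂_eq h rfl Γ hΦ, eqToHom_refl, Category.comp_id]

/-- Collation, as a strict 2-functor from invertible distributive laws of pseudofunctors to
pseudo-bifunctors. -/
def collateFunctor (hK : ∀ S : InvDistLaw B C D, S.toDistLaw.collate.IsPseudo) :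
    StrictPseudofunctor (InvDist B C D) (PseudoBifun B C D) := .mk'
  { obj S := ⟨S.toDistLaw.collate, hK S⟩
    map θ := InducedBicategory.mkHom (DistHom.collate θ.hom)
    map₂ Γ := InducedBicategory.mkHom₂ (DistHom₂.collate Γ.hom)
    map₂_id _ := rfl
    map₂_comp _ _ := rfl
    map_id S := InducedBicategory.hom_ext (DistHom.collate_id S.toDistLaw)
    map_comp θ ζ := InducedBicategory.hom_ext (DistHom.collate_comp θ.hom ζ.hom)
    map₂_whisker_left _ _ _ _ := PseudoBifun.hom₂_eq _ _ _ fun _ => HEq.rfl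
    map₂_whisker_right _ _ := PseudoBifun.hom₂_eq _ _ _ fun _ => HEq.rfl
    map₂_left_unitor _ := PseudoBifun.hom₂_eq' _ _ fun _ => HEq.rfl
    map₂_right_unitor _ := PseudoBifun.hom₂_eq' _ _ fun _ => HEq.rfl
    map₂_associator _ _ _ := PseudoBifun.hom₂_eq _ _ _ fun _ => HEq.rfl }

namespace PseudoBifunctor

/-- The distributive law between the restrictions of a pseudo-bifunctor. -/
noncomputable def restrictLaw (P : PseudoBifunctor B C D) (h : P.toLax.restrictData.IsDistLaw) :
    DistLaw B C D where
  toDistData := P.toLax.restrictData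
  law := h

/-- The morphism of distributive laws between the restrictions of an oplax transformation. -/
noncomputable def restrictHom {P Q : PseudoBifunctor B C D} (hP : P.toLax.restrictData.IsDistLaw)
    (hQ : Q.toLax.restrictData.IsDistLaw) (θ : P.toLax ⟶ Q.toLax)
    (hθ : (restrictHomData θ).YangBaxter) : DistHom (P.restrictLaw hP) (Q.restrictLaw hQ) where
  toDistHomData := restrictHomData θ
  yangBaxter := hθ

/-- The 2-morphism of distributive laws between the restrictions of a modification. -/
def restrictHom₂ {P Q : PseudoBifunctor B C D} {hP : P.toLax.restrictData.IsDistLaw}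
    {hQ : Q.toLax.restrictData.IsDistLaw} {θ ζ : P.toLax ⟶ Q.toLax}
    {hθ : (restrictHomData θ).YangBaxter} {hζ : (restrictHomData ζ).YangBaxter} (Γ : θ ⟶ ζ) :
    DistHom₂ (restrictHom hP hQ θ hθ) (restrictHom hP hQ ζ hζ) where
  app b c := Γ.as.app (b, c)
  naturality_B b _ _ g := Γ.as.naturality (LaxFunctor.inR b g)
  naturality_C c _ _ f := Γ.as.naturality (LaxFunctor.inL f c)

end PseudoBifunctor

/-- Restriction to each variable, as a strict 2-functor from pseudo-bifunctors to invertible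
distributive laws of pseudofunctors. The arguments say that it takes values in distributive laws,
that these are invertible laws of pseudofunctors, and that it takes oplax transformations to
morphisms of distributive laws. -/
noncomputable def restrictFunctor
    (hT : ∀ P : PseudoBifunctor B C D, P.toLax.restrictData.IsDistLaw)
    (hT' : ∀ P : PseudoBifunctor B C D, P.toLax.restrictData.IsInvertible)
    (hY : ∀ (P Q : PseudoBifunctor B C D) (θ : P.toLax ⟶ Q.toLax),
      (restrictHomData θ).YangBaxter) :
    StrictPseudofunctor (PseudoBifun B C D) (InvDist B C D) := .mk'
  { obj P := ⟨PseudoBifunctor.restrictLaw P (hT P), hT' P⟩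
    map {P Q} θ := InducedBicategory.mkHom
      (PseudoBifunctor.restrictHom (hT P) (hT Q) θ.hom (hY P Q θ.hom))
    map₂ Γ := InducedBicategory.mkHom₂ (PseudoBifunctor.restrictHom₂ Γ.hom)
    map₂_id _ := rfl
    map₂_comp _ _ := rfl
    map_id _ := rfl
    map_comp _ _ := rfl
    map₂_whisker_left _ _ _ _ := InvDist.hom₂_eq _ _ _ fun _ _ => HEq.rfl
    map₂_whisker_right _ _ := InvDist.hom₂_eq _ _ _ fun _ _ => HEq.rfl
    map₂_left_unitor _ := InvDist.hom₂_eq' _ _ fun _ _ => HEq.rfl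
    map₂_right_unitor _ := InvDist.hom₂_eq' _ _ fun _ _ => HEq.rfl
    map₂_associator _ _ _ := InvDist.hom₂_eq _ _ _ fun _ _ => HEq.rfl }

/-- A strict 2-natural isomorphism between strict 2-functors: a family of invertible 1-morphisms
natural with respect to 1-morphisms and 2-morphisms. -/
structure TwoNatIso {X : Type*} [Bicategory X] {Y : Type*} [Bicategory Y]
    (F G : StrictPseudofunctor X Y) where
  app (a : X) : F.obj a ⟶ G.obj a
  isIso_app (a : X) : IsIsoOneCell (app a)
  naturality {a b : X} (f : a ⟶ b) : F.map f ≫ app b = app a ≫ G.map f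
  naturality₂ {a b : X} {f g : a ⟶ b} (η : f ⟶ g) :
    F.map₂ η ▷ app b ≫ eqToHom (naturality g) = eqToHom (naturality f) ≫ app a ◁ G.map₂ η

/-! ### The canonical comparison 2-morphisms -/

namespace DistLaw

/-- The components of the canonical transformation from `M b` to the restriction `P(b, -)` of the
collation `P`, given by the unitors of the family `L`. -/
def kappaM (S : DistLaw B C D) (b : B) {c₁ c₂ : C} (g : c₁ ⟶ c₂) :
    (S.M b).map g ≫ 𝟙 (S.obj b c₂) ⟶ 𝟙 (S.obj b c₁) ≫ (S.collate.fixLeftOn b).map g :=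
  (ρ_ _).hom ≫ (λ_ _).inv ≫ (S.L c₁).mapId b ▷ (S.M b).map g ≫ (λ_ _).inv

/-- The components of the canonical transformation from `L c` to the restriction `P(-, c)` of the
collation `P`, given by the unitors of the family `M`. -/
def kappaL (S : DistLaw B C D) (c : C) {b₁ b₂ : B} (f : b₁ ⟶ b₂) :
    (S.L c).map f ≫ 𝟙 (S.obj b₂ c) ⟶ 𝟙 (S.obj b₁ c) ≫ (S.collate.fixRightOn c).map f :=
  (ρ_ _).hom ≫ (ρ_ _).inv ≫ (S.L c).map f ◁ (S.M b₂).mapId c ≫ (λ_ _).inv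

end DistLaw

/-- The components of the canonical transformation from the collation of the restrictions of a
pseudo-bifunctor `P` to `P`, given by the compositors of `P`. -/
noncomputable def PseudoBifunctor.lambda (P : PseudoBifunctor B C D)
    (h : P.toLax.restrictData.IsDistLaw) {x y : B × C} (f : x ⟶ y) :
    (P.restrictLaw h).collate.map f ≫ 𝟙 (P.toLax.obj y) ⟶
      𝟙 (P.toLax.obj x) ≫ P.toLax.map f :=
  (ρ_ _).hom ≫ P.toLax.mapComp (LaxFunctor.inL f.1 x.2) (LaxFunctor.inR y.1 f.2) ≫
    P.toLax.map₂ (LaxFunctor.factor f) ≫ (λ_ _).inv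

end

end CategoryTheory

/-! Every 1-morphism `(f, g)` of `B × C` factors as `(f, 𝟙)` followed by `(𝟙, g)`. Since the
compositors of a pseudo-bifunctor `P` are invertible, `P` is determined up to isomorphism by its two
families of restrictions, together with the way the two kinds of factors commute. That last datum is
`σ`: it compares the compositors of `(𝟙, g)`, `(f, 𝟙)` and of `(f, 𝟙)`, `(𝟙, g)`, both of which land
in `P(f, g)`.

For restriction, `restrictσ_mapComp` characterises `σ` by its composite with an invertible
compositor. Each axiom of a distributive law can therefore be tested after cancelling that
compositor. The `compTo` calculus then moves both sides to one normal form, consisting of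
compositors of `P` followed by the image of a single 2-morphism of `B × C`, and only coherence of
unitors and associators remains. The Yang–Baxter equation for the restrictions of `θ` is, in the
same way, the naturality of `θ` at the 2-morphism `interchange` (`restrictHomData_yangBaxter`).

For the round trips, both comparisons have identity 1-morphism components, so each is an `Icon`: a
family of 2-morphisms `F f ⟶ G f` compatible with the lax structure. An invertible icon has an
inverse icon, and strictness of `D` turns this into a strict inverse of the transformation. The
comparison `κ` inserts unitors. By `collate_factor` and `collate_braid`, the compositors of the
collation applied to inserted units return an identity in one order and the original `σ` in the
other; this gives `icon_yangBaxter`. The comparison `λ` is a compositor of `P`, and its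
compatibility with composition comes from `compTo_interchange` and `compTo_whisker_compTo`. Strict
2-naturality follows from the axioms of oplax transformations and the fact that, in a strict `D`,
unitors are `eqToHom`s. -/

namespace CategoryTheory

section

variable {A : Type*} [Bicategory A]
variable {B : Type u₁} [Bicategory.{w₁, v₁} B] {C : Type u₂} [Bicategory.{w₂, v₂} C]
  {D : Type u₃} [Bicategory.{w₃, v₃} D]

/-! ### Calculus of compositors followed by the image of a 2-morphism. -/

namespace LaxFunctor

/-- The compositor of a lax functor followed by the image of a 2-morphism. -/
def compTo (F : A ⥤ᴸ D) {a b c : A} (f : a ⟶ b) (g : b ⟶ c) {h : a ⟶ c} (t : f ≫ g ⟶ h) :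
    F.map f ≫ F.map g ⟶ F.map h :=
  F.mapComp f g ≫ F.map₂ t

section

variable (F : A ⥤ᴸ D)

theorem compTo_id {a b c : A} (f : a ⟶ b) (g : b ⟶ c) : F.compTo f g (𝟙 _) = F.mapComp f g := by
  simp [compTo]

theorem compTo_map₂ {a b c : A} (f : a ⟶ b) (g : b ⟶ c) {h h' : a ⟶ c} (t : f ≫ g ⟶ h)
    (s : h ⟶ h') : F.compTo f g t ≫ F.map₂ s = F.compTo f g (t ≫ s) := by
  simp [compTo]

theorem whiskerRight_compTo {a b c : A} {f f' : a ⟶ b} (η : f ⟶ f') (g : b ⟶ c) {h : a ⟶ c}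
    (t : f' ≫ g ⟶ h) : F.map₂ η ▷ F.map g ≫ F.compTo f' g t = F.compTo f g (η ▷ g ≫ t) := by
  simp only [compTo, PrelaxFunctor.map₂_comp, mapComp_naturality_left_assoc]

theorem whiskerLeft_compTo {a b c : A} (f : a ⟶ b) {g g' : b ⟶ c} (η : g ⟶ g') {h : a ⟶ c}
    (t : f ≫ g' ⟶ h) : F.map f ◁ F.map₂ η ≫ F.compTo f g' t = F.compTo f g (f ◁ η ≫ t) := by
  simp only [compTo, PrelaxFunctor.map₂_comp, mapComp_naturality_right_assoc]

/-- Naturality of the compositor moves `s` to the end, and the associativity axiom rebrackets to the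
right. Together with `compTo_assoc_right` this gathers all 2-morphisms of `A` into one final
argument of `compTo`. -/
theorem compTo_assoc_left {a b c d : A} (f : a ⟶ b) (g : b ⟶ c) (h : c ⟶ d) {k : a ⟶ c}
    {l : a ⟶ d} (s : f ≫ g ⟶ k) (t : k ≫ h ⟶ l) :
    F.compTo f g s ▷ F.map h ≫ F.compTo k h t =
      (α_ _ _ _).hom ≫ F.map f ◁ F.mapComp g h ≫ F.compTo f (g ≫ h) ((α_ _ _ _).inv ≫ s ▷ h ≫ t) := by
  simp only [compTo, comp_whiskerRight, Category.assoc, PrelaxFunctor.map₂_comp]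
  rw [← F.mapComp_naturality_left_assoc, F.mapComp_assoc_left_assoc]

theorem compTo_assoc_right {a b c d : A} (f : a ⟶ b) (g : b ⟶ c) (h : c ⟶ d) {k : b ⟶ d}
    {l : a ⟶ d} (s : g ≫ h ⟶ k) (t : f ≫ k ⟶ l) :
    F.map f ◁ F.compTo g h s ≫ F.compTo f k t =
      (α_ _ _ _).inv ≫ F.mapComp f g ▷ F.map h ≫ F.compTo (f ≫ g) h ((α_ _ _ _).hom ≫ f ◁ s ≫ t) := by
  simp only [compTo, Bicategory.whiskerLeft_comp, Category.assoc, PrelaxFunctor.map₂_comp]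
  rw [← F.mapComp_naturality_right_assoc, F.mapComp_assoc_right_assoc]

theorem whiskerLeft_compTo_compTo {a b c d : A} (f : a ⟶ b) (g : b ⟶ c) (h : c ⟶ d) {k : b ⟶ d}
    {l : a ⟶ d} (s : g ≫ h ⟶ k) (t : f ≫ k ⟶ l) :
    F.map f ◁ F.compTo g h s ≫ F.compTo f k t =
      F.map f ◁ F.mapComp g h ≫ F.compTo f (g ≫ h) (f ◁ s ≫ t) := by
  rw [compTo, Bicategory.whiskerLeft_comp, Category.assoc, whiskerLeft_compTo]

theorem compTo_whiskerRight_compTo {a b c d : A} (f : a ⟶ b) (g : b ⟶ c) (h : c ⟶ d) {k : a ⟶ c}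
    {l : a ⟶ d} (s : f ≫ g ⟶ k) (t : k ≫ h ⟶ l) :
    F.compTo f g s ▷ F.map h ≫ F.compTo k h t =
      F.mapComp f g ▷ F.map h ≫ F.compTo (f ≫ g) h (s ▷ h ≫ t) := by
  rw [compTo, comp_whiskerRight, Category.assoc, whiskerRight_compTo]

theorem mapId_whiskerRight_compTo {a b : A} (f : a ⟶ b) {h : a ⟶ b} (t : 𝟙 a ≫ f ⟶ h) :
    F.mapId a ▷ F.map f ≫ F.compTo (𝟙 a) f t = (λ_ _).hom ≫ F.map₂ ((λ_ f).inv ≫ t) := by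
  simp [compTo]

theorem whiskerLeft_mapId_compTo {a b : A} (f : a ⟶ b) {h : a ⟶ b} (t : f ≫ 𝟙 b ⟶ h) :
    F.map f ◁ F.mapId b ≫ F.compTo f (𝟙 b) t = (ρ_ _).hom ≫ F.map₂ ((ρ_ f).inv ≫ t) := by
  simp [compTo]

instance isIso_compTo [F.IsPseudo] {a b c : A} (f : a ⟶ b) (g : b ⟶ c) {h : a ⟶ c}
    (t : f ≫ g ⟶ h) [IsIso t] : IsIso (F.compTo f g t) := by
  unfold compTo
  have : IsIso (F.map₂ t) := inferInstanceAs (IsIso ((F.mapFunctor _ _).map t))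
  infer_instance

end

/-! ### The restrictions of a pseudo-bifunctor form an invertible distributive law. -/

section

variable (P : (B × C) ⥤ᴸ D) [P.IsPseudo]

/-- This determines `σ`, because the compositor on the left is invertible. It is the only fact about
`σ` that the verification of the axioms needs. -/
theorem restrictσ_mapComp {b₁ b₂ : B} (f : b₁ ⟶ b₂) {c₁ c₂ : C} (g : c₁ ⟶ c₂) :
    P.restrictσ f g ≫ P.mapComp (inL f c₁) (inR b₂ g) =
      P.compTo (inR b₁ g) (inL f c₂) (interchange f g) := by
  simp [restrictσ, compTo]

theorem restrictσ_compTo {b₁ b₂ : B} (f : b₁ ⟶ b₂) {c₁ c₂ : C} (g : c₁ ⟶ c₂)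
    {h : (b₁, c₁) ⟶ (b₂, c₂)} (t : inL f c₁ ≫ inR b₂ g ⟶ h) :
    P.restrictσ f g ≫ P.compTo (inL f c₁) (inR b₂ g) t =
      P.compTo (inR b₁ g) (inL f c₂) (interchange f g ≫ t) := by
  rw [compTo, reassoc_of% P.restrictσ_mapComp f g, compTo_map₂]

/-- After composition with the compositor of `(f, 𝟙)` and `(𝟙, g₁ ≫ g₂)`, each `σ` is absorbed into
a compositor, and both sides become the threefold compositor of `(𝟙, g₁)`, `(𝟙, g₂)`, `(f, 𝟙)`. The
compositor of `P(b, -)` appears as a `compTo` because `𝟙 ≫ 𝟙` must be brought back to `𝟙`. -/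
theorem restrictData_comp_M {b₁ b₂ : B} (f : b₁ ⟶ b₂) {c₁ c₂ c₃ : C} (g₁ : c₁ ⟶ c₂)
    (g₂ : c₂ ⟶ c₃) :
    P.compTo (inR b₁ g₁) (inR b₁ g₂) (h := inR b₁ (g₁ ≫ g₂)) ((ρ_ (𝟙 b₁)).hom, 𝟙 _) ▷
        P.map (inL f c₃) ≫ P.restrictσ f (g₁ ≫ g₂) =
      (α_ _ _ _).hom ≫ P.map (inR b₁ g₁) ◁ P.restrictσ f g₂ ≫ (α_ _ _ _).inv ≫
        P.restrictσ f g₁ ▷ P.map (inR b₂ g₂) ≫ (α_ _ _ _).hom ≫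
          P.map (inL f c₁) ◁
            P.compTo (inR b₂ g₁) (inR b₂ g₂) (h := inR b₂ (g₁ ≫ g₂)) ((ρ_ (𝟙 b₂)).hom, 𝟙 _) := by
  rw [← cancel_mono (P.mapComp (inL f c₁) (inR b₂ (g₁ ≫ g₂)))]
  simp only [Category.assoc]
  rw [restrictσ_mapComp, compTo_assoc_left, ← P.compTo_id (inL f c₁), compTo_assoc_right,
    Iso.hom_inv_id_assoc, ← comp_whiskerRight_assoc, restrictσ_mapComp, compTo_assoc_left,
    Iso.inv_hom_id_assoc, ← whiskerLeft_comp_assoc, restrictσ_mapComp, whiskerLeft_compTo_compTo]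
  -- What is left is an equality of composites of unitors and associators in `B × C`, checked in
  -- each factor.
  congr 3
  exact Prod.ext (by simp) (by simp)

theorem restrictData_comp_L {b₁ b₂ b₃ : B} (f₁ : b₁ ⟶ b₂) (f₂ : b₂ ⟶ b₃) {c₁ c₂ : C}
    (g : c₁ ⟶ c₂) :
    P.map (inR b₁ g) ◁
        P.compTo (inL f₁ c₂) (inL f₂ c₂) (h := inL (f₁ ≫ f₂) c₂) (𝟙 _, (λ_ (𝟙 c₂)).hom) ≫
          P.restrictσ (f₁ ≫ f₂) g =
      (α_ _ _ _).inv ≫ P.restrictσ f₁ g ▷ P.map (inL f₂ c₂) ≫ (α_ _ _ _).hom ≫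
        P.map (inL f₁ c₁) ◁ P.restrictσ f₂ g ≫ (α_ _ _ _).inv ≫
          P.compTo (inL f₁ c₁) (inL f₂ c₁) (h := inL (f₁ ≫ f₂) c₁) (𝟙 _, (λ_ (𝟙 c₁)).hom) ▷
            P.map (inR b₃ g) := by
  rw [← cancel_mono (P.mapComp (inL (f₁ ≫ f₂) c₁) (inR b₃ g))]
  simp only [Category.assoc]
  rw [restrictσ_mapComp, compTo_assoc_right, ← P.compTo_id (inL (f₁ ≫ f₂) c₁), compTo_assoc_left,
    Iso.inv_hom_id_assoc, ← whiskerLeft_comp_assoc, restrictσ_mapComp, compTo_assoc_right,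
    Iso.hom_inv_id_assoc, ← comp_whiskerRight_assoc, restrictσ_mapComp, compTo_whiskerRight_compTo]
  congr 3
  exact Prod.ext (by simp) (by simp)

theorem restrictData_unit_M {b₁ b₂ : B} (f : b₁ ⟶ b₂) (c : C) :
    P.mapId (b₁, c) ▷ P.map (inL f c) ≫ P.restrictσ f (𝟙 c) =
      (λ_ _).hom ≫ (ρ_ _).inv ≫ P.map (inL f c) ◁ P.mapId (b₂, c) := by
  rw [← cancel_mono (P.mapComp (inL f c) (inR b₂ (𝟙 c)))]
  simp only [Category.assoc]
  rw [restrictσ_mapComp, ← compTo_id]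
  -- The unitor lands in `P.map (𝟙 (b, c))`, which matches `P.map (inR b (𝟙 c))` and `P.map (inL (𝟙
  -- b) c)` only after unfolding the identities of the product.
  erw [mapId_whiskerRight_compTo, whiskerLeft_mapId_compTo]
  rw [Iso.inv_hom_id_assoc]
  congr 2
  exact Prod.ext (by simp) (by simp)

theorem restrictData_unit_L (b : B) {c₁ c₂ : C} (g : c₁ ⟶ c₂) :
    P.map (inR b g) ◁ P.mapId (b, c₂) ≫ P.restrictσ (𝟙 b) g =
      (ρ_ _).hom ≫ (λ_ _).inv ≫ P.mapId (b, c₁) ▷ P.map (inR b g) := by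
  rw [← cancel_mono (P.mapComp (inL (𝟙 b) c₁) (inR b g))]
  simp only [Category.assoc]
  rw [restrictσ_mapComp, ← compTo_id]
  erw [mapId_whiskerRight_compTo, whiskerLeft_mapId_compTo]
  rw [Iso.inv_hom_id_assoc]
  congr 2
  exact Prod.ext (by simp) (by simp)

theorem restrictData_nat_M {b₁ b₂ : B} (f : b₁ ⟶ b₂) {c₁ c₂ : C} {g g' : c₁ ⟶ c₂} (β : g ⟶ g') :
    P.map₂ (a := (b₁, c₁)) (b := (b₁, c₂)) (f := inR b₁ g) (g := inR b₁ g') (𝟙 _, β) ▷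
        P.map (inL f c₂) ≫ P.restrictσ f g' =
      P.restrictσ f g ≫ P.map (inL f c₁) ◁
        P.map₂ (a := (b₂, c₁)) (b := (b₂, c₂)) (f := inR b₂ g) (g := inR b₂ g') (𝟙 _, β) := by
  rw [← cancel_mono (P.mapComp (inL f c₁) (inR b₂ g'))]
  simp only [Category.assoc]
  rw [restrictσ_mapComp, ← P.compTo_id (inL f c₁), whiskerRight_compTo, whiskerLeft_compTo, restrictσ_compTo]
  congr 1
  exact Prod.ext (by simp) (by simp)

theorem restrictData_nat_L {b₁ b₂ : B} {f f' : b₁ ⟶ b₂} (α : f ⟶ f') {c₁ c₂ : C} (g : c₁ ⟶ c₂) :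
    P.map (inR b₁ g) ◁
        P.map₂ (a := (b₁, c₂)) (b := (b₂, c₂)) (f := inL f c₂) (g := inL f' c₂) (α, 𝟙 _) ≫
          P.restrictσ f' g =
      P.restrictσ f g ≫
        P.map₂ (a := (b₁, c₁)) (b := (b₂, c₁)) (f := inL f c₁) (g := inL f' c₁) (α, 𝟙 _) ▷
          P.map (inR b₂ g) := by
  rw [← cancel_mono (P.mapComp (inL f' c₁) (inR b₂ g))]
  simp only [Category.assoc]
  rw [restrictσ_mapComp, ← P.compTo_id (inL f' c₁), whiskerRight_compTo, whiskerLeft_compTo, restrictσ_compTo]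
  congr 1
  exact Prod.ext (by simp) (by simp)

/-- The inclusion of `C` at `b` preserves identities on the nose, so the unitor of the composite
differs from that of `P` only by the image of an identity 2-morphism. -/
theorem restrictData_mapId_M (b : B) (c : C) :
    (P.restrictData.M b).mapId c = P.mapId (b, c) := by
  change P.mapId (b, c) ≫ P.map₂ (𝟙 (𝟙 (b, c))) = _
  rw [PrelaxFunctor.map₂_id, Category.comp_id]

theorem restrictData_mapId_L (b : B) (c : C) :
    (P.restrictData.L c).mapId b = P.mapId (b, c) := by
  change P.mapId (b, c) ≫ P.map₂ (𝟙 (𝟙 (b, c))) = _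
  rw [PrelaxFunctor.map₂_id, Category.comp_id]

theorem restrictData_isDistLaw : P.restrictData.IsDistLaw where
  comp_M := P.restrictData_comp_M
  comp_L := P.restrictData_comp_L
  unit_M f c := by
    rw [restrictData_mapId_M, restrictData_mapId_M]
    exact P.restrictData_unit_M f c
  unit_L b _ _ g := by
    rw [restrictData_mapId_L, restrictData_mapId_L]
    exact P.restrictData_unit_L b g
  nat_M := P.restrictData_nat_M
  nat_L := P.restrictData_nat_L

/-- `interchange` is built from unitors, so `σ` is one invertible compositor divided by another. -/
theorem isIso_restrictσ {b₁ b₂ : B} (f : b₁ ⟶ b₂) {c₁ c₂ : C} (g : c₁ ⟶ c₂) :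
    IsIso (P.restrictσ f g) := by
  have : IsIso (interchange f g) := ⟨((ρ_ f).hom ≫ (λ_ f).inv, (λ_ g).hom ≫ (ρ_ g).inv),
    Prod.ext (by simp) (by simp), Prod.ext (by simp) (by simp)⟩
  have h := P.restrictσ_mapComp f g
  rw [← IsIso.eq_comp_inv] at h
  rw [h]
  infer_instance

theorem restrictData_isInvertible : P.restrictData.IsInvertible where
  pseudo_M b :=
    { isIso_mapId := fun c => by
        change IsIso ((P.restrictData.M b).mapId c)
        rw [restrictData_mapId_M]
        exact IsPseudo.isIso_mapId (b, c)
      isIso_mapComp := fun {c₁ c₂ c₃} g₁ g₂ =>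
        have : IsIso (show inR b g₁ ≫ inR b g₂ ⟶ inR b (g₁ ≫ g₂) from ((ρ_ (𝟙 b)).hom, 𝟙 _)) :=
          ⟨((ρ_ (𝟙 b)).inv, 𝟙 _), Prod.ext (by simp) (by simp), Prod.ext (by simp) (by simp)⟩
        P.isIso_compTo (inR b g₁) (inR b g₂) (h := inR b (g₁ ≫ g₂)) ((ρ_ (𝟙 b)).hom, 𝟙 _) }
  pseudo_L c :=
    { isIso_mapId := fun b => by
        change IsIso ((P.restrictData.L c).mapId b)
        rw [restrictData_mapId_L]
        exact IsPseudo.isIso_mapId (b, c)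
      isIso_mapComp := fun {b₁ b₂ b₃} f₁ f₂ =>
        have : IsIso (show inL f₁ c ≫ inL f₂ c ⟶ inL (f₁ ≫ f₂) c from (𝟙 _, (λ_ (𝟙 c)).hom)) :=
          ⟨(𝟙 _, (λ_ (𝟙 c)).inv), Prod.ext (by simp) (by simp), Prod.ext (by simp) (by simp)⟩
        P.isIso_compTo (inL f₁ c) (inL f₂ c) (h := inL (f₁ ≫ f₂) c) (𝟙 _, (λ_ (𝟙 c)).hom) }
  isIso_σ f _ _ g := P.isIso_restrictσ f g

end

/-! ### Oplax transformations restrict to morphisms of distributive laws. -/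

section

variable {F G : A ⥤ᴸ D} (θ : F ⟶ G)

/-- The composition axiom of `θ` at `f`, `g`, merged with its naturality at `t`. -/
theorem compTo_whiskerRight_naturality {a b c : A} (f : a ⟶ b) (g : b ⟶ c) {h : a ⟶ c}
    (t : f ≫ g ⟶ h) :
    F.compTo f g t ▷ θ.app c ≫ θ.naturality h =
      (α_ _ _ _).hom ≫ F.map f ◁ θ.naturality g ≫ (α_ _ _ _).inv ≫ θ.naturality f ▷ G.map g ≫
        (α_ _ _ _).hom ≫ θ.app a ◁ G.compTo f g t :=
  precomp_aux₂ (θ.naturality_comp f g) (θ.naturality_naturality t)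

end

/-- Both sides, followed by a compositor of `Q`, express the component of `θ` at `(f, 𝟙) ≫ (𝟙, g)`
precomposed with a compositor of `P` and the image of `interchange`. One side decomposes it along
`(f, 𝟙)`, `(𝟙, g)`, the other along `(𝟙, g)`, `(f, 𝟙)`. -/
theorem restrictHomData_yangBaxter {P Q : (B × C) ⥤ᴸ D} [P.IsPseudo] [Q.IsPseudo] (θ : P ⟶ Q) :
    (restrictHomData θ).YangBaxter := by
  intro b₁ b₂ f c₁ c₂ g
  change P.map (inR b₁ g) ◁ θ.naturality (inL f c₂) ≫ (α_ _ _ _).inv ≫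
      θ.naturality (inR b₁ g) ▷ Q.map (inL f c₂) ≫ (α_ _ _ _).hom ≫
        θ.app (b₁, c₁) ◁ Q.restrictσ f g =
    (α_ _ _ _).inv ≫ P.restrictσ f g ▷ θ.app (b₂, c₂) ≫ (α_ _ _ _).hom ≫
      P.map (inL f c₁) ◁ θ.naturality (inR b₂ g) ≫ (α_ _ _ _).inv ≫
        θ.naturality (inL f c₁) ▷ Q.map (inR b₂ g) ≫ (α_ _ _ _).hom
  -- The cancelled 2-morphism is invertible because `Q` is pseudo; it absorbs the inverse hidden in
  -- `Q.restrictσ`.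
  rw [← cancel_mono (θ.app (b₁, c₁) ◁ Q.mapComp (inL f c₁) (inR b₂ g))]
  simp only [Category.assoc]
  rw [← Bicategory.whiskerLeft_comp, restrictσ_mapComp, ← Q.compTo_id,
    ← compTo_whiskerRight_naturality, ← comp_whiskerRight_assoc, P.compTo_id, restrictσ_mapComp,
    compTo_whiskerRight_naturality, Iso.inv_hom_id_assoc]

end LaxFunctor

/-! ### Invertibility of the collation, and extensionality of transformations. -/

/-- The collation of an invertible distributive law of pseudofunctors is a pseudo-bifunctor. -/
theorem DistLaw.collate_isPseudo (S : DistLaw B C D) (hS : S.IsInvertible) :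
    S.collate.IsPseudo where
  isIso_mapId x := by
    have : IsIso ((S.L x.2).mapId x.1) := (hS.pseudo_L x.2).isIso_mapId x.1
    have : IsIso ((S.M x.1).mapId x.2) := (hS.pseudo_M x.1).isIso_mapId x.2
    change IsIso (S.collateId x.1 x.2)
    infer_instance
  isIso_mapComp {x y z} f g := by
    have : IsIso ((S.L x.2).mapComp f.1 g.1) := (hS.pseudo_L x.2).isIso_mapComp f.1 g.1
    have : IsIso ((S.M z.1).mapComp f.2 g.2) := (hS.pseudo_M z.1).isIso_mapComp f.2 g.2
    have := hS.isIso_σ g.1 f.2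
    change IsIso (S.collateComp f.1 g.1 f.2 g.2)
    infer_instance

/-- The 1-morphism components agree only propositionally in a strict `D` (as with `𝟙 ≫ 𝟙` and `𝟙`),
so the 2-morphism components are compared along `eqToHom`: the family of `eqToHom`s has to be a
modification. -/
theorem oplaxTrans_ext {F G : A ⥤ᴸ D} {η θ : F ⟶ G} (h : ∀ a, η.app a = θ.app a)
    (hn : ∀ {a b : A} (f : a ⟶ b), F.map f ◁ eqToHom (h b) ≫ θ.naturality f =
      η.naturality f ≫ eqToHom (h a) ▷ G.map f) : η = θ := by
  obtain ⟨p, x, _, _, _⟩ := η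
  obtain ⟨q, y, _, _, _⟩ := θ
  obtain rfl : p = q := funext h
  have : @x = @y := by
    funext a b f
    simpa using (hn f).symm
  subst this
  rfl

/-- The analogue of `oplaxTrans_ext` for both families at once; Yang–Baxter is a proposition and
adds no condition. -/
theorem distHom_ext {S T : DistLaw B C D} {θ ζ : S ⟶ T} (h : ∀ b c, θ.app b c = ζ.app b c)
    (hB : ∀ (b : B) {c₁ c₂ : C} (g : c₁ ⟶ c₂),
      (S.M b).map g ◁ eqToHom (h b c₂) ≫ (ζ.θB b).naturality g =
        (θ.θB b).naturality g ≫ eqToHom (h b c₁) ▷ (T.M b).map g)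
    (hC : ∀ (c : C) {b₁ b₂ : B} (f : b₁ ⟶ b₂),
      (S.L c).map f ◁ eqToHom (h b₂ c) ≫ (ζ.θC c).naturality f =
        (θ.θC c).naturality f ≫ eqToHom (h b₁ c) ▷ (T.L c).map f) : θ = ζ := by
  obtain ⟨⟨p, x, y⟩, _⟩ := θ
  obtain ⟨⟨q, x', y'⟩, _⟩ := ζ
  obtain rfl : p = q := funext fun b => funext fun c => h b c
  have h₁ : x = x' := by
    funext b
    refine OplaxOn.toOplax_injective fun g => ?_
    have := hB b g
    rw [eqToHom_refl, eqToHom_refl, Bicategory.whiskerLeft_id, id_whiskerRight] at this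
    exact ((Category.id_comp _).symm.trans (this.trans (Category.comp_id _))).symm
  have h₂ : y = y' := by
    funext c
    refine OplaxOn.toOplax_injective fun f => ?_
    have := hC c f
    rw [eqToHom_refl, eqToHom_refl, Bicategory.whiskerLeft_id, id_whiskerRight] at this
    exact ((Category.id_comp _).symm.trans (this.trans (Category.comp_id _))).symm
  subst h₁ h₂
  rfl

/-! ### Transformations with identity 1-morphism components. -/

theorem unitCell_comp_unitCell {a b : D} {f g : a ⟶ b} {k : f ⟶ g} {k' : g ⟶ f} (h : k ≫ k' = 𝟙 f) :
    f ◁ (λ_ (𝟙 b)).hom ≫ (ρ_ f).hom ≫ (λ_ f).inv =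
      ((α_ _ _ _).inv ≫ ((ρ_ f).hom ≫ k ≫ (λ_ g).inv) ▷ 𝟙 b ≫ (α_ _ _ _).hom ≫
        𝟙 a ◁ ((ρ_ g).hom ≫ k' ≫ (λ_ f).inv) ≫ (α_ _ _ _).inv) ≫ (λ_ (𝟙 a)).hom ▷ f := by
  symm
  calc
    _ = 𝟙 _ ⊗≫ (k ≫ k') ⊗≫ 𝟙 _ := by
      bicategory
    _ = _ := by
      rw [h]; bicategory

theorem unitCell_naturality {a b : D} {f f' g g' : a ⟶ b} {η : f ⟶ f'} {η' : g ⟶ g'}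
    {k : f ⟶ g} {k' : f' ⟶ g'} (h : η ≫ k' = k ≫ η') :
    η ▷ 𝟙 b ≫ (ρ_ f').hom ≫ k' ≫ (λ_ g').inv = ((ρ_ f).hom ≫ k ≫ (λ_ g).inv) ≫ 𝟙 a ◁ η' := by
  simp [reassoc_of% h]

theorem unitCell_id {a : D} {f g : a ⟶ a} {i : 𝟙 a ⟶ f} {j : 𝟙 a ⟶ g} {k : f ⟶ g}
    (h : i ≫ k = j) :
    i ▷ 𝟙 a ≫ (ρ_ f).hom ≫ k ≫ (λ_ g).inv = (λ_ (𝟙 a)).hom ≫ (ρ_ (𝟙 a)).inv ≫ 𝟙 a ◁ j := by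
  simp [← h, unitors_equal]

theorem unitCell_comp {a b c : D} {f f' : a ⟶ b} {g g' : b ⟶ c} {h h' : a ⟶ c} {m : f ≫ g ⟶ h}
    {m' : f' ≫ g' ⟶ h'} {k : f ⟶ f'} {l : g ⟶ g'} {n : h ⟶ h'}
    (H : m ≫ n = k ▷ g ≫ f' ◁ l ≫ m') :
    m ▷ 𝟙 c ≫ (ρ_ h).hom ≫ n ≫ (λ_ h').inv =
      (α_ _ _ _).hom ≫ f ◁ ((ρ_ g).hom ≫ l ≫ (λ_ g').inv) ≫ (α_ _ _ _).inv ≫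
        ((ρ_ f).hom ≫ k ≫ (λ_ f').inv) ▷ g' ≫ (α_ _ _ _).hom ≫ 𝟙 a ◁ m' := by
  rw [← whisker_exchange_assoc] at H
  calc
    _ = (ρ_ _).hom ≫ (m ≫ n) ≫ (λ_ _).inv := by simp
    _ = _ := by rw [H]; bicategory

/-- Strictness of `D` enters here: the unitor `𝟙 ≫ 𝟙 ≅ 𝟙` is an `eqToHom`, so a coherence identity
becomes an equality of transformations through the extensionality lemmas. -/
theorem unitCell_comp_unitCell_eqToHom [Strict D] {a b : D} {f g : a ⟶ b} {k : f ⟶ g}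
    {k' : g ⟶ f} (h : k ≫ k' = 𝟙 f) (ha : 𝟙 a ≫ 𝟙 a = 𝟙 a) (hb : 𝟙 b ≫ 𝟙 b = 𝟙 b) :
    f ◁ eqToHom hb ≫ (ρ_ f).hom ≫ (λ_ f).inv =
      ((α_ _ _ _).inv ≫ ((ρ_ f).hom ≫ k ≫ (λ_ g).inv) ▷ 𝟙 b ≫ (α_ _ _ _).hom ≫
        𝟙 a ◁ ((ρ_ g).hom ≫ k' ≫ (λ_ f).inv) ≫ (α_ _ _ _).inv) ≫ eqToHom ha ▷ f := by
  have := unitCell_comp_unitCell h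
  rwa [Strict.leftUnitor_eqToIso (𝟙 a), Strict.leftUnitor_eqToIso (𝟙 b)] at this

/-- An icon between lax functors with the same action on objects: an oplax transformation with
identity 1-morphism components, with the unitors removed. -/
structure Icon {ob : A → D} (F G : LaxOn ob) where
  cell {a b : A} (f : a ⟶ b) : F.map f ⟶ G.map f
  cell_naturality {a b : A} {f g : a ⟶ b} (η : f ⟶ g) : F.map₂ η ≫ cell g = cell f ≫ G.map₂ η
  cell_id (a : A) : F.mapId a ≫ cell (𝟙 a) = G.mapId a
  cell_comp {a b c : A} (f : a ⟶ b) (g : b ⟶ c) :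
    F.mapComp f g ≫ cell (f ≫ g) = cell f ▷ F.map g ≫ G.map f ◁ cell g ≫ G.mapComp f g

namespace Icon

variable {ob : A → D} {F G : LaxOn ob}

/-- The oplax transformation with identity components given by an icon. -/
def toOplaxOn (k : Icon F G) : OplaxOn F.toLax G.toLax (fun a => 𝟙 (ob a)) where
  naturality f := (ρ_ (F.map f)).hom ≫ k.cell f ≫ (λ_ (G.map f)).inv
  naturality_naturality η := unitCell_naturality (k.cell_naturality η)
  naturality_id a := unitCell_id (k.cell_id a)
  naturality_comp f g := unitCell_comp (k.cell_comp f g)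

/-- The oplax transformation with identity components given by an icon. -/
def toOplax (k : Icon F G) : F.toLax ⟶ G.toLax :=
  k.toOplaxOn.toOplax

/-- The inverse of an icon with invertible components. -/
noncomputable def inv (k : Icon F G) (hk : ∀ {a b : A} (f : a ⟶ b), IsIso (k.cell f)) :
    Icon G F where
  cell f := CategoryTheory.inv (k.cell f)
  cell_naturality η := by
    rw [IsIso.comp_inv_eq, Category.assoc, k.cell_naturality, IsIso.inv_hom_id_assoc]
  cell_id a := by rw [← k.cell_id, Category.assoc, IsIso.hom_inv_id, Category.comp_id]
  cell_comp f g := by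
    rw [IsIso.comp_inv_eq, Category.assoc, Category.assoc, k.cell_comp]
    -- Interchange moves the inverse at `g` to the front, so that the two cells at `f` meet and
    -- cancel; the cells at `g` cancel afterwards.
    rw [← whisker_exchange_assoc, ← comp_whiskerRight_assoc, IsIso.inv_hom_id,
      ← whisker_exchange_assoc]
    simp

theorem cell_comp_inv (k : Icon F G) (hk : ∀ {a b : A} (f : a ⟶ b), IsIso (k.cell f)) {a b : A}
    (f : a ⟶ b) : k.cell f ≫ (k.inv hk).cell f = 𝟙 _ :=
  IsIso.hom_inv_id _

theorem inv_cell_comp (k : Icon F G) (hk : ∀ {a b : A} (f : a ⟶ b), IsIso (k.cell f)) {a b : A}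
    (f : a ⟶ b) : (k.inv hk).cell f ≫ k.cell f = 𝟙 _ :=
  IsIso.inv_hom_id _

variable [Strict D]

theorem toOplax_comp_toOplax {k : Icon F G} {k' : Icon G F}
    (h : ∀ {a b : A} (f : a ⟶ b), k.cell f ≫ k'.cell f = 𝟙 _) :
    k.toOplax ≫ k'.toOplax = 𝟙 F.toLax := by
  exact oplaxTrans_ext (fun a => Strict.id_comp (𝟙 (ob a)))
    fun f => unitCell_comp_unitCell_eqToHom (h f) _ _

theorem isPseudonaturalIso (k : Icon F G) (hk : ∀ {a b : A} (f : a ⟶ b), IsIso (k.cell f)) :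
    IsPseudonaturalIso k.toOplax := by
  refine ⟨fun a b f => ?_, (k.inv hk).toOplax,
    toOplax_comp_toOplax (k.cell_comp_inv hk), toOplax_comp_toOplax (k.inv_cell_comp hk)⟩
  have := hk f
  change IsIso ((ρ_ (F.map f)).hom ≫ k.cell f ≫ (λ_ (G.map f)).inv)
  infer_instance

end Icon

/-! ### Inserting units into the compositors of a collation. -/

namespace LaxOn

variable {ob : A → D} (F : LaxOn ob)

theorem mapId_whiskerRight_mapComp {a b : A} (f : a ⟶ b) :
    F.mapId a ▷ F.map f ≫ F.mapComp (𝟙 a) f ≫ F.map₂ (λ_ f).hom = (λ_ (F.map f)).hom :=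
  (F.toLax.map₂_leftUnitor_hom f).symm

theorem whiskerLeft_mapId_mapComp {a b : A} (f : a ⟶ b) :
    F.map f ◁ F.mapId b ≫ F.mapComp f (𝟙 b) ≫ F.map₂ (ρ_ f).hom = (ρ_ (F.map f)).hom :=
  (F.toLax.map₂_rightUnitor_hom f).symm

end LaxOn

/-- Compatibility of `M b ⟶ P(b, -)` with composition. By `h₁`, `σ` carries the inner unitor of `L`
to the left of `M`; there `h₂`, a unit law of `L`, absorbs it. Here `r` is the image of the unitor
`𝟙 ≫ 𝟙 ≅ 𝟙`. -/
theorem collate_unitL_comp {a b c : D} {M : a ⟶ b} {M' : b ⟶ c} {M'' : a ⟶ c} {L L'' : a ⟶ a}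
    {L' : b ⟶ b} {mM : M ≫ M' ⟶ M''} {i : 𝟙 a ⟶ L} {i' : 𝟙 b ⟶ L'} {σ : M ≫ L' ⟶ L ≫ M}
    {mL : L ≫ L ⟶ L''} {r : L'' ⟶ L}
    (h₁ : M ◁ i' ≫ σ = (ρ_ _).hom ≫ (λ_ _).inv ≫ i ▷ M)
    (h₂ : L ◁ i ≫ mL ≫ r = (ρ_ _).hom) :
    mM ≫ (λ_ _).inv ≫ i ▷ M'' =
      ((λ_ _).inv ≫ i ▷ M) ▷ M' ≫ (L ≫ M) ◁ ((λ_ _).inv ≫ i' ▷ M') ≫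
        ((α_ _ _ _).hom ≫ L ◁ ((α_ _ _ _).inv ≫ σ ▷ M' ≫ (α_ _ _ _).hom) ≫ (α_ _ _ _).inv ≫
          mL ▷ (M ≫ M') ≫ L'' ◁ mM) ≫ r ▷ M'' ≫ L ◁ 𝟙 M'' := by
  symm
  calc
    _ = 𝟙 _ ⊗≫ i ▷ (M ≫ M') ⊗≫ L ◁ (M ◁ i' ≫ σ) ▷ M' ⊗≫ mL ▷ (M ≫ M') ⊗≫
        (L'' ◁ mM ≫ r ▷ M'') ⊗≫ 𝟙 _ := by
      bicategory
    _ = 𝟙 _ ⊗≫ i ▷ (M ≫ M') ⊗≫ (L ◁ i ≫ mL ≫ r) ▷ (M ≫ M') ⊗≫ L ◁ mM ⊗≫ 𝟙 _ := by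
      rw [h₁, whisker_exchange]; bicategory
    _ = 𝟙 _ ⊗≫ (i ▷ (M ≫ M') ≫ L ◁ mM) ⊗≫ 𝟙 _ := by
      rw [h₂]; bicategory
    _ = _ := by
      rw [← whisker_exchange]; bicategory

/-- The mirror image of `collate_unitL_comp`, with the inner unitor of `M` carried to the right of
`L'`. -/
theorem collate_unitM_comp {a b c : D} {L : a ⟶ b} {L' : b ⟶ c} {L'' : a ⟶ c} {M : b ⟶ b}
    {M' M'' : c ⟶ c} {mL : L ≫ L' ⟶ L''} {i : 𝟙 b ⟶ M} {i' : 𝟙 c ⟶ M'}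
    {σ : M ≫ L' ⟶ L' ≫ M'} {mM : M' ≫ M' ⟶ M''} {r : M'' ⟶ M'}
    (h₁ : i ▷ L' ≫ σ = (λ_ _).hom ≫ (ρ_ _).inv ≫ L' ◁ i')
    (h₂ : i' ▷ M' ≫ mM ≫ r = (λ_ _).hom) :
    mL ≫ (ρ_ _).inv ≫ L'' ◁ i' =
      ((ρ_ _).inv ≫ L ◁ i) ▷ L' ≫ (L ≫ M) ◁ ((ρ_ _).inv ≫ L' ◁ i') ≫
        ((α_ _ _ _).hom ≫ L ◁ ((α_ _ _ _).inv ≫ σ ▷ M' ≫ (α_ _ _ _).hom) ≫ (α_ _ _ _).inv ≫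
          mL ▷ (M' ≫ M') ≫ L'' ◁ mM) ≫ 𝟙 L'' ▷ M'' ≫ L'' ◁ r := by
  symm
  calc
    _ = 𝟙 _ ⊗≫ L ◁ (i ▷ L' ≫ M ◁ ((ρ_ _).inv ≫ L' ◁ i')) ⊗≫ L ◁ σ ▷ M' ⊗≫
        mL ▷ (M' ≫ M') ⊗≫ L'' ◁ (mM ≫ r) ⊗≫ 𝟙 _ := by
      bicategory
    _ = 𝟙 _ ⊗≫ L ◁ L' ◁ i' ⊗≫ L ◁ (i ▷ L' ≫ σ) ▷ M' ⊗≫ mL ▷ (M' ≫ M') ⊗≫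
        L'' ◁ (mM ≫ r) ⊗≫ 𝟙 _ := by
      rw [← whisker_exchange]; bicategory
    _ = 𝟙 _ ⊗≫ L ◁ L' ◁ i' ⊗≫ ((L ≫ L') ◁ (i' ▷ M') ≫ mL ▷ (M' ≫ M')) ⊗≫
        L'' ◁ (mM ≫ r) ⊗≫ 𝟙 _ := by
      rw [h₁]; bicategory
    _ = 𝟙 _ ⊗≫ ((L ≫ L') ◁ i' ≫ mL ▷ M') ⊗≫ L'' ◁ (i' ▷ M' ≫ mM ≫ r) ⊗≫ 𝟙 _ := by
      rw [whisker_exchange]; bicategory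
    _ = _ := by
      rw [h₂, whisker_exchange]; bicategory

/-- For the collation `P`: expand `P(f, g) = L f ≫ M g` to `P(f, 𝟙) ≫ P(𝟙, g)` by unitors and
compose again. The inner `σ` only meets units, so it disappears by `h₁` and the unit laws do the
rest. -/
theorem collate_factor {a b c : D} {L L' : a ⟶ b} {L₁ : b ⟶ b} {M M' : b ⟶ c} {M₁ : b ⟶ b}
    {i : 𝟙 b ⟶ L₁} {j : 𝟙 b ⟶ M₁} {σ : M₁ ≫ L₁ ⟶ L₁ ≫ M₁} {mL : L ≫ L₁ ⟶ L'} {mM : M₁ ≫ M ⟶ M'}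
    {r : L' ⟶ L} {l : M' ⟶ M}
    (h₁ : j ▷ L₁ ≫ σ = (λ_ _).hom ≫ (ρ_ _).inv ≫ L₁ ◁ j)
    (h₂ : L ◁ i ≫ mL ≫ r = (ρ_ _).hom) (h₃ : j ▷ M ≫ mM ≫ l = (λ_ _).hom) :
    L ◁ ((λ_ _).inv ≫ i ▷ M) ≫ ((ρ_ _).inv ≫ L ◁ j) ▷ (L₁ ≫ M) ≫
      ((α_ _ _ _).hom ≫ L ◁ ((α_ _ _ _).inv ≫ σ ▷ M ≫ (α_ _ _ _).hom) ≫ (α_ _ _ _).inv ≫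
        mL ▷ (M₁ ≫ M) ≫ L' ◁ mM) ≫ r ▷ M' ≫ L ◁ l = 𝟙 _ := by
  calc
    _ = 𝟙 _ ⊗≫ L ◁ i ▷ M ⊗≫ L ◁ (j ▷ L₁ ≫ σ) ▷ M ⊗≫ mL ▷ (M₁ ≫ M) ⊗≫
        (L' ◁ mM ≫ r ▷ M') ⊗≫ L ◁ l ⊗≫ 𝟙 _ := by
      bicategory
    _ = 𝟙 _ ⊗≫ L ◁ i ▷ M ⊗≫ ((L ≫ L₁) ◁ (j ▷ M) ≫ (mL ≫ r) ▷ (M₁ ≫ M)) ⊗≫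
        L ◁ (mM ≫ l) ⊗≫ 𝟙 _ := by
      rw [h₁, whisker_exchange]; bicategory
    _ = 𝟙 _ ⊗≫ (L ◁ i ≫ mL ≫ r) ▷ M ⊗≫ L ◁ (j ▷ M ≫ mM ≫ l) ⊗≫ 𝟙 _ := by
      rw [whisker_exchange]; bicategory
    _ = _ := by
      rw [h₂, h₃]; bicategory

/-- In the other order, `M g ≫ L f` expands to `P(𝟙, g) ≫ P(f, 𝟙)`. The units now lie outside and
are absorbed by the unit laws, and the inner `σ` survives. -/
theorem collate_braid {a b c d : D} {L L' : a ⟶ d} {L₁ : a ⟶ a} {L₂ : b ⟶ c} {M : a ⟶ b}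
    {M₁ : c ⟶ c} {M₂ M₂' : d ⟶ c}
    {i : 𝟙 a ⟶ L₁} {j : 𝟙 c ⟶ M₁} {σ : M ≫ L₂ ⟶ L ≫ M₂} {mL : L₁ ≫ L ⟶ L'} {mM : M₂ ≫ M₁ ⟶ M₂'}
    {r : L' ⟶ L} {l : M₂' ⟶ M₂}
    (h₂ : i ▷ L ≫ mL ≫ r = (λ_ _).hom) (h₃ : M₂ ◁ j ≫ mM ≫ l = (ρ_ _).hom) :
    M ◁ ((ρ_ _).inv ≫ L₂ ◁ j) ≫ ((λ_ _).inv ≫ i ▷ M) ▷ (L₂ ≫ M₁) ≫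
      ((α_ _ _ _).hom ≫ L₁ ◁ ((α_ _ _ _).inv ≫ σ ▷ M₁ ≫ (α_ _ _ _).hom) ≫ (α_ _ _ _).inv ≫
        mL ▷ (M₂ ≫ M₁) ≫ L' ◁ mM) ≫ r ▷ M₂' ≫ L ◁ l = σ := by
  calc
    _ = 𝟙 _ ⊗≫ (M ≫ L₂) ◁ j ⊗≫ (i ▷ (M ≫ L₂ ≫ M₁) ≫ L₁ ◁ (α_ _ _ _).inv ≫ L₁ ◁ σ ▷ M₁) ⊗≫
        mL ▷ (M₂ ≫ M₁) ⊗≫ (L' ◁ mM ≫ r ▷ M₂') ⊗≫ L ◁ l ⊗≫ 𝟙 _ := by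
      bicategory
    _ = 𝟙 _ ⊗≫ ((M ≫ L₂) ◁ j ≫ σ ▷ M₁) ⊗≫ (i ▷ L ≫ mL ≫ r) ▷ (M₂ ≫ M₁) ⊗≫
         L ◁ (mM ≫ l) ⊗≫ 𝟙 _ := by
      rw [← Bicategory.whiskerLeft_comp, ← whisker_exchange, whisker_exchange r]; bicategory
    _ = 𝟙 _ ⊗≫ σ ⊗≫ L ◁ (M₂ ◁ j ≫ mM ≫ l) ⊗≫ 𝟙 _ := by
      rw [whisker_exchange, h₂]; bicategory
    _ = _ := by
      rw [h₃]; bicategory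

theorem unitCell_yangBaxter {a b c d : D} {M M' : a ⟶ b} {L L' : a ⟶ c} {N N' : c ⟶ d}
    {K K' : b ⟶ d} {σ : M ≫ K ⟶ L ≫ N} {σ' : M' ≫ K' ⟶ L' ≫ N'} {m : M ⟶ M'} {n : N ⟶ N'}
    {l : L ⟶ L'} {k : K ⟶ K'} (h : M ◁ k ≫ m ▷ K' ≫ σ' = σ ≫ L ◁ n ≫ l ▷ N') :
    M ◁ ((ρ_ K).hom ≫ k ≫ (λ_ K').inv) ≫ (α_ M (𝟙 b) K').inv ≫
        ((ρ_ M).hom ≫ m ≫ (λ_ M').inv) ▷ K' ≫ (α_ _ _ _).hom ≫ 𝟙 a ◁ σ' =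
      (α_ M K (𝟙 d)).inv ≫ σ ▷ 𝟙 d ≫ (α_ _ _ _).hom ≫ L ◁ ((ρ_ N).hom ≫ n ≫ (λ_ N').inv) ≫
        (α_ L (𝟙 c) N').inv ≫ ((ρ_ L).hom ≫ l ≫ (λ_ L').inv) ▷ N' ≫ (α_ _ _ _).hom := by
  calc
    _ = 𝟙 _ ⊗≫ (M ◁ k ≫ m ▷ K' ≫ σ') ⊗≫ 𝟙 _ := by bicategory
    _ = _ := by rw [h]; bicategory

/-- By interchange, the inverse of `M ◁ k ≫ m ▷ K'` is the corresponding composite of `inv k` and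
`inv m`, and similarly on the other side. The equation is then conjugated by these. -/
theorem yangBaxter_inv {a b c d : D} {M M' : a ⟶ b} {L L' : a ⟶ c} {N N' : c ⟶ d}
    {K K' : b ⟶ d} {σ : M ≫ K ⟶ L ≫ N} {σ' : M' ≫ K' ⟶ L' ≫ N'} {m : M ⟶ M'} {n : N ⟶ N'}
    {l : L ⟶ L'} {k : K ⟶ K'} (_ : IsIso m) (_ : IsIso n) (_ : IsIso l) (_ : IsIso k)
    (h : M ◁ k ≫ m ▷ K' ≫ σ' = σ ≫ L ◁ n ≫ l ▷ N') :
    M' ◁ inv k ≫ inv m ▷ K ≫ σ = σ' ≫ L' ◁ inv n ≫ inv l ▷ N := by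
  have hX : (M' ◁ inv k ≫ inv m ▷ K) ≫ M ◁ k ≫ m ▷ K' = 𝟙 _ := by
    rw [Category.assoc, ← whisker_exchange_assoc]
    simp
  have hY : (L ◁ n ≫ l ▷ N') ≫ L' ◁ inv n ≫ inv l ▷ N = 𝟙 _ := by
    rw [Category.assoc, ← whisker_exchange_assoc]
    simp
  calc
    _ = (M' ◁ inv k ≫ inv m ▷ K) ≫ σ ≫ (L ◁ n ≫ l ▷ N') ≫ L' ◁ inv n ≫ inv l ▷ N := by
      rw [hY, Category.comp_id, Category.assoc]
    _ = ((M' ◁ inv k ≫ inv m ▷ K) ≫ M ◁ k ≫ m ▷ K') ≫ σ' ≫ L' ◁ inv n ≫ inv l ▷ N := by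
      simp only [Category.assoc]; rw [reassoc_of% h]
    _ = _ := by rw [hX, Category.id_comp]

theorem comp_eq_of_splitting {X : Type*} [Category* X] {a b c d e : X} {x : a ⟶ b} {y : b ⟶ c}
    {σ' : c ⟶ d} {t : d ⟶ e} {s : c ⟶ e} {σ : a ⟶ e} {z : X} {u : e ⟶ z} {v : z ⟶ d} (ht : IsIso t)
    (h : σ' ≫ t = s) (h₁ : u ≫ v ≫ t = 𝟙 e) (h₂ : x ≫ y ≫ s = σ) :
    x ≫ y ≫ σ' = σ ≫ u ≫ v := by
  rw [← cancel_mono t]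
  simp [h, h₁, h₂]

/-! ### The comparison of a distributive law with the restrictions of its collation. -/

namespace DistLaw

variable (S : DistLaw B C D)

/-- The icon `M b ⟶ P(b, -)` for the collation `P`, given by the unitors of the family `L`. -/
def iconM (b : B) : Icon (S.M b) (S.collate.fixLeftOn b) where
  cell {c₁ _} g := (λ_ _).inv ≫ (S.L c₁).mapId b ▷ (S.M b).map g
  cell_naturality {c₁ c₂ g g'} β := by
    change (S.M b).map₂ β ≫ (λ_ _).inv ≫ (S.L c₁).mapId b ▷ (S.M b).map g' =
      ((λ_ _).inv ≫ (S.L c₁).mapId b ▷ (S.M b).map g) ≫ (S.L c₁).map₂ (𝟙 (𝟙 b)) ▷ (S.M b).map g ≫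
        (S.L c₁).map (𝟙 b) ◁ (S.M b).map₂ β
    rw [LaxOn.map₂_id, id_whiskerRight, Category.id_comp, Category.assoc, ← whisker_exchange]
    simp
  cell_id c := by
    change (S.M b).mapId c ≫ (λ_ _).inv ≫ (S.L c).mapId b ▷ (S.M b).map (𝟙 c) =
      ((λ_ _).inv ≫ (S.L c).mapId b ▷ 𝟙 (S.obj b c) ≫ (S.L c).map (𝟙 b) ◁ (S.M b).mapId c) ≫
        S.collateMap₂ (𝟙 (𝟙 b)) (𝟙 (𝟙 c))
    rw [DistData.collateMap₂, LaxOn.map₂_id, LaxOn.map₂_id, ← whisker_exchange]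
    simp
  cell_comp {c₁ c₂ c₃} g g' := by
    refine (collate_unitL_comp (S.law.unit_L b g) ((S.L c₁).whiskerLeft_mapId_mapComp (𝟙 b))).trans
      ?_
    -- The compositor of `P(b, -)` ends with the image of `(ρ, 𝟙)` under `P`; its second factor must
    -- appear as `map₂ (𝟙 _)` for the two sides to agree by unfolding.
    rw [← LaxOn.map₂_id]
    rfl

/-- The icon `L c ⟶ P(-, c)` for the collation `P`, given by the unitors of the family `M`. -/
def iconL (c : C) : Icon (S.L c) (S.collate.fixRightOn c) where
  cell {_ b₂} f := (ρ_ _).inv ≫ (S.L c).map f ◁ (S.M b₂).mapId c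
  cell_naturality {b₁ b₂ f f'} α := by
    change (S.L c).map₂ α ≫ (ρ_ _).inv ≫ (S.L c).map f' ◁ (S.M b₂).mapId c =
      ((ρ_ _).inv ≫ (S.L c).map f ◁ (S.M b₂).mapId c) ≫ (S.L c).map₂ α ▷ (S.M b₂).map (𝟙 c) ≫
        (S.L c).map f' ◁ (S.M b₂).map₂ (𝟙 (𝟙 c))
    rw [LaxOn.map₂_id, Bicategory.whiskerLeft_id, Category.comp_id, Category.assoc,
      whisker_exchange]
    simp
  cell_id b := by
    change (S.L c).mapId b ≫ (ρ_ _).inv ≫ (S.L c).map (𝟙 b) ◁ (S.M b).mapId c =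
      ((λ_ _).inv ≫ (S.L c).mapId b ▷ 𝟙 (S.obj b c) ≫ (S.L c).map (𝟙 b) ◁ (S.M b).mapId c) ≫
        S.collateMap₂ (𝟙 (𝟙 b)) (𝟙 (𝟙 c))
    rw [DistData.collateMap₂, LaxOn.map₂_id, LaxOn.map₂_id]
    simp [unitors_inv_equal]
  cell_comp {b₁ b₂ b₃} f f' := by
    refine (collate_unitM_comp (S.law.unit_M f' c)
      ((S.M b₃).mapId_whiskerRight_mapComp (𝟙 c))).trans ?_
    rw [← LaxOn.map₂_id]
    rfl

variable {S}

theorem isIso_iconM_cell (hS : S.IsInvertible) (b : B) {c₁ c₂ : C} (g : c₁ ⟶ c₂) :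
    IsIso ((S.iconM b).cell g) := by
  have : IsIso ((S.L c₁).mapId b) := (hS.pseudo_L c₁).isIso_mapId b
  change IsIso ((λ_ _).inv ≫ (S.L c₁).mapId b ▷ (S.M b).map g)
  infer_instance

theorem isIso_iconL_cell (hS : S.IsInvertible) (c : C) {b₁ b₂ : B} (f : b₁ ⟶ b₂) :
    IsIso ((S.iconL c).cell f) := by
  have : IsIso ((S.M b₂).mapId c) := (hS.pseudo_M b₂).isIso_mapId c
  change IsIso ((ρ_ _).inv ≫ (S.L c).map f ◁ (S.M b₂).mapId c)
  infer_instance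

/-- Both sides are tested by composing into `P(f, g)` with an invertible compositor of the
collation. By `collate_braid` the left side becomes `σ`, and by `collate_factor` the right side
becomes `σ` followed by an identity. -/
theorem icon_yangBaxter [S.collate.IsPseudo] {b₁ b₂ : B} (f : b₁ ⟶ b₂) {c₁ c₂ : C} (g : c₁ ⟶ c₂) :
    (S.M b₁).map g ◁ (S.iconL c₂).cell f ≫
        (S.iconM b₁).cell g ▷ ((S.L c₂).map f ≫ (S.M b₂).map (𝟙 c₂)) ≫ S.collate.restrictσ f g =
      S.σ f g ≫ (S.L c₁).map f ◁ (S.iconM b₂).cell g ≫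
        (S.iconL c₁).cell f ▷ ((S.L c₁).map (𝟙 b₂) ≫ (S.M b₂).map g) := by
  -- The maps `t` and `s` contract the two factorisations of `(f, g)`, and `interchange` relates
  -- them.
  let t : LaxFunctor.inL f c₁ ≫ LaxFunctor.inR b₂ g ⟶ ((f, g) : (b₁, c₁) ⟶ (b₂, c₂)) :=
    ((ρ_ f).hom, (λ_ g).hom)
  let s : LaxFunctor.inR b₁ g ≫ LaxFunctor.inL f c₂ ⟶ ((f, g) : (b₁, c₁) ⟶ (b₂, c₂)) :=
    ((λ_ f).hom, (ρ_ g).hom)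
  have : IsIso t := ⟨((ρ_ f).inv, (λ_ g).inv), Prod.ext (by simp [t]) (by simp [t]),
    Prod.ext (by simp [t]) (by simp [t])⟩
  have hs : LaxFunctor.interchange f g ≫ t = s := Prod.ext (by simp [s, t]) (by simp [s, t])
  have h₁ := collate_factor (S.law.unit_M (𝟙 b₂) c₁) ((S.L c₁).whiskerLeft_mapId_mapComp f)
    ((S.M b₂).mapId_whiskerRight_mapComp g)
  have h₂ := collate_braid (σ := S.σ f g) ((S.L c₁).mapId_whiskerRight_mapComp f)
    ((S.M b₂).whiskerLeft_mapId_mapComp g)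
  have h := S.collate.restrictσ_compTo f g t
  rw [hs] at h
  exact comp_eq_of_splitting (S.collate.isIso_compTo _ _ t) h h₁ h₂

variable (S)

/-- The canonical comparison between a distributive law and the restrictions of its collation. -/
def kappaHomData [S.collate.IsPseudo] : DistHomData S.toDistData S.collate.restrictData where
  app b c := 𝟙 (S.obj b c)
  θB b := (S.iconM b).toOplaxOn
  θC c := (S.iconL c).toOplaxOn

theorem kappaHomData_yangBaxter [S.collate.IsPseudo] : S.kappaHomData.YangBaxter :=
  fun _ _ f _ _ g => unitCell_yangBaxter (icon_yangBaxter f g)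

/-- The inverse of the comparison between an invertible distributive law of pseudofunctors and the
restrictions of its collation. -/
noncomputable def kappaInvHomData [S.collate.IsPseudo] (hS : S.IsInvertible) :
    DistHomData S.collate.restrictData S.toDistData where
  app b c := 𝟙 (S.obj b c)
  θB b := ((S.iconM b).inv (isIso_iconM_cell hS b)).toOplaxOn
  θC c := ((S.iconL c).inv (isIso_iconL_cell hS c)).toOplaxOn

theorem kappaInvHomData_yangBaxter [S.collate.IsPseudo] (hS : S.IsInvertible) :
    (S.kappaInvHomData hS).YangBaxter := fun b₁ b₂ f c₁ c₂ g =>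
  unitCell_yangBaxter (yangBaxter_inv (isIso_iconM_cell hS b₁ g) (isIso_iconM_cell hS b₂ g)
    (isIso_iconL_cell hS c₁ f) (isIso_iconL_cell hS c₂ f) (icon_yangBaxter f g))

end DistLaw

/-! ### Naturality of the comparisons with respect to transformations. -/

theorem unitCell_natural {a b a' b' : D} {F G : a ⟶ b} {F' G' : a' ⟶ b'} {p : a ⟶ a'}
    {r : b ⟶ b'} {k : F ⟶ G} {k' : F' ⟶ G'} {u : F ≫ r ⟶ p ≫ F'} {v : G ≫ r ⟶ p ≫ G'}
    (h : k ▷ r ≫ v = u ≫ p ◁ k') :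
    F ◁ ((ρ_ r).hom ≫ (λ_ r).inv) ≫ (α_ _ _ _).inv ≫ ((ρ_ F).hom ≫ k ≫ (λ_ G).inv) ▷ r ≫
        (α_ _ _ _).hom ≫ 𝟙 a ◁ v ≫ (α_ _ _ _).inv =
      ((α_ _ _ _).inv ≫ u ▷ 𝟙 b' ≫ (α_ _ _ _).hom ≫ p ◁ ((ρ_ F').hom ≫ k' ≫ (λ_ G').inv) ≫
        (α_ _ _ _).inv) ≫ ((ρ_ p).hom ≫ (λ_ p).inv) ▷ G' := by
  calc
    _ = 𝟙 _ ⊗≫ (k ▷ r ≫ v) ⊗≫ 𝟙 _ := by bicategory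
    _ = _ := by rw [h]; bicategory

theorem eqToHom_comp_id_id_comp [Strict D] {a b : D} (p : a ⟶ b) (h : p ≫ 𝟙 b = 𝟙 a ≫ p) :
    eqToHom h = (ρ_ p).hom ≫ (λ_ p).inv := by
  rw [Strict.leftUnitor_eqToIso, Strict.rightUnitor_eqToIso]
  simp

/-- Each component of the 2-dimensional naturality of `κ` and of `λ` is an instance of this. -/
theorem whiskerRight_id_comp_eqToHom [Strict D] {a b : D} {p q : a ⟶ b} (η : p ⟶ q)
    (h : p ≫ 𝟙 b = 𝟙 a ≫ p) (h' : q ≫ 𝟙 b = 𝟙 a ≫ q) :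
    η ▷ 𝟙 b ≫ eqToHom h' = eqToHom h ≫ 𝟙 a ◁ η := by
  rw [eqToHom_comp_id_id_comp, eqToHom_comp_id_id_comp]
  simp

theorem unitCell_natural_eqToHom [Strict D] {a b a' b' : D} {F G : a ⟶ b} {F' G' : a' ⟶ b'}
    {p : a ⟶ a'} {r : b ⟶ b'} {k : F ⟶ G} {k' : F' ⟶ G'} {u : F ≫ r ⟶ p ≫ F'}
    {v : G ≫ r ⟶ p ≫ G'} (h : k ▷ r ≫ v = u ≫ p ◁ k') (hr : r ≫ 𝟙 b' = 𝟙 b ≫ r)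
    (hp : p ≫ 𝟙 a' = 𝟙 a ≫ p) :
    F ◁ eqToHom hr ≫ (α_ _ _ _).inv ≫ ((ρ_ F).hom ≫ k ≫ (λ_ G).inv) ▷ r ≫
        (α_ _ _ _).hom ≫ 𝟙 a ◁ v ≫ (α_ _ _ _).inv =
      ((α_ _ _ _).inv ≫ u ▷ 𝟙 b' ≫ (α_ _ _ _).hom ≫ p ◁ ((ρ_ F').hom ≫ k' ≫ (λ_ G').inv) ≫
        (α_ _ _ _).inv) ≫ eqToHom hp ▷ G' := by
  rw [eqToHom_comp_id_id_comp, eqToHom_comp_id_id_comp]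
  exact unitCell_natural h

/-- The unitor of `L` slides past the component `x` by interchange, and then the unit axiom `h` of
the transformation on `L` applies. -/
theorem unitL_natural {a b a' b' : D} {M : a ⟶ b} {M' : a' ⟶ b'} {L : a ⟶ a} {L' : a' ⟶ a'}
    {p : a ⟶ a'} {r : b ⟶ b'} {i : 𝟙 a ⟶ L} {i' : 𝟙 a' ⟶ L'} {y : L ≫ p ⟶ p ≫ L'}
    (x : M ≫ r ⟶ p ≫ M') (h : i ▷ p ≫ y = (λ_ p).hom ≫ (ρ_ p).inv ≫ p ◁ i') :
    ((λ_ M).inv ≫ i ▷ M) ▷ r ≫ DistHomData.paste y x = x ≫ p ◁ ((λ_ M').inv ≫ i' ▷ M') := by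
  dsimp only [DistHomData.paste]
  calc
    _ = 𝟙 _ ⊗≫ (i ▷ (M ≫ r) ≫ L ◁ x) ⊗≫ y ▷ M' ⊗≫ 𝟙 _ := by bicategory
    _ = 𝟙 _ ⊗≫ x ⊗≫ (i ▷ p ≫ y) ▷ M' ⊗≫ 𝟙 _ := by rw [← whisker_exchange]; bicategory
    _ = _ := by rw [h]; bicategory

theorem unitM_natural {a b a' b' : D} {L : a ⟶ b} {L' : a' ⟶ b'} {M : b ⟶ b} {M' : b' ⟶ b'}
    {p : a ⟶ a'} {r : b ⟶ b'} {i : 𝟙 b ⟶ M} {i' : 𝟙 b' ⟶ M'} {x : M ≫ r ⟶ r ≫ M'}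
    (y : L ≫ r ⟶ p ≫ L') (h : i ▷ r ≫ x = (λ_ r).hom ≫ (ρ_ r).inv ≫ r ◁ i') :
    ((ρ_ L).inv ≫ L ◁ i) ▷ r ≫ DistHomData.paste y x = y ≫ p ◁ ((ρ_ L').inv ≫ L' ◁ i') := by
  dsimp only [DistHomData.paste]
  calc
    _ = 𝟙 _ ⊗≫ L ◁ (i ▷ r ≫ x) ⊗≫ y ▷ M' ⊗≫ 𝟙 _ := by bicategory
    _ = 𝟙 _ ⊗≫ ((L ≫ r) ◁ i' ≫ y ▷ M') ⊗≫ 𝟙 _ := by rw [h]; bicategory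
    _ = _ := by rw [whisker_exchange]; bicategory

/-! ### The comparison from the collation of the restrictions to the pseudo-bifunctor. -/

namespace LaxFunctor

/-- Normal form of collated composition followed by a compositor: `σ` on the inner factors `b`, `c`
becomes the image of `τ`, and everything reduces to the fourfold compositor of `a`, `b`, `c`, `d`.
-/
theorem compTo_interchange (F : A ⥤ᴸ D) {x y z w z' : A} {a : x ⟶ y} {b : y ⟶ z} {c : z ⟶ w}
    {v : A} {d : w ⟶ v} {c' : y ⟶ z'} {b' : z' ⟶ w} {l : x ⟶ z'} {m : z' ⟶ v} {n : x ⟶ v}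
    {σ : F.map b ≫ F.map c ⟶ F.map c' ≫ F.map b'} {τ : b ≫ c ⟶ c' ≫ b'}
    (hσ : σ ≫ F.mapComp c' b' = F.compTo b c τ) (s : a ≫ c' ⟶ l) (t : b' ≫ d ⟶ m)
    (u : l ≫ m ⟶ n) :
    ((α_ _ _ _).hom ≫ F.map a ◁ ((α_ _ _ _).inv ≫ σ ▷ F.map d ≫ (α_ _ _ _).hom) ≫
      (α_ _ _ _).inv ≫ F.compTo a c' s ▷ (F.map b' ≫ F.map d) ≫ F.map l ◁ F.compTo b' d t) ≫
        F.compTo l m u =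
      (α_ _ _ _).hom ≫ F.map a ◁ F.map b ◁ F.mapComp c d ≫ F.map a ◁ F.mapComp b (c ≫ d) ≫
        F.compTo a (b ≫ c ≫ d) (a ◁ ((α_ _ _ _).inv ≫ τ ▷ d ≫ (α_ _ _ _).hom) ≫
          (α_ _ _ _).inv ≫ s ▷ (b' ≫ d) ≫ l ◁ t ≫ u) := by
  -- The part to the right of `a`: braiding and then composing the three factors equals composing
  -- them unbraided and applying the image of `τ ▷ d`.
  have key : ((α_ _ _ _).inv ≫ σ ▷ F.map d ≫ (α_ _ _ _).hom) ≫ F.map c' ◁ F.mapComp b' d ≫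
      F.mapComp c' (b' ≫ d) = F.map b ◁ F.mapComp c d ≫ F.mapComp b (c ≫ d) ≫
        F.map₂ ((α_ _ _ _).inv ≫ τ ▷ d ≫ (α_ _ _ _).hom) := by
    simp only [Category.assoc]
    rw [F.mapComp_assoc_right, Iso.hom_inv_id_assoc, ← comp_whiskerRight_assoc, hσ]
    change _ ≫ _ ≫ F.compTo _ _ _ = _ ≫ F.compTo _ _ _
    rw [compTo_assoc_left, Iso.inv_hom_id_assoc]
  simp only [Category.assoc]
  rw [whiskerLeft_compTo_compTo, ← whisker_exchange_assoc, compTo_assoc_left, comp_whiskerLeft_assoc,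
    Iso.inv_hom_id_assoc, Iso.inv_hom_id_assoc, ← whiskerLeft_comp_assoc, ← whiskerLeft_comp_assoc,
    Category.assoc (_ ≫ _ ≫ _) (_ ◁ _), key]
  simp only [Bicategory.whiskerLeft_comp, Category.assoc, whiskerLeft_compTo]

/-- The same fourfold normal form, reached by composing the outer pairs first; to be compared with
`compTo_interchange`. -/
theorem compTo_whisker_compTo (F : A ⥤ᴸ D) {x y z w v : A} {a : x ⟶ y} {b : y ⟶ z} {c : z ⟶ w}
    {d : w ⟶ v} {f : x ⟶ z} {g : z ⟶ v} (s : a ≫ b ⟶ f) (t : c ≫ d ⟶ g) :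
    F.compTo a b s ▷ (F.map c ≫ F.map d) ≫ F.map f ◁ F.compTo c d t ≫ F.mapComp f g =
      (α_ _ _ _).hom ≫ F.map a ◁ F.map b ◁ F.mapComp c d ≫ F.map a ◁ F.mapComp b (c ≫ d) ≫
        F.compTo a (b ≫ c ≫ d) ((α_ _ _ _).inv ≫ s ▷ (c ≫ d) ≫ f ◁ t) := by
  rw [← F.compTo_id f g, whiskerLeft_compTo_compTo, Category.comp_id, ← whisker_exchange_assoc,
    compTo_assoc_left]
  simp

end LaxFunctor

namespace PseudoBifunctor

open LaxFunctor

variable (P : PseudoBifunctor B C D) (hP : P.toLax.restrictData.IsDistLaw)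

/-- The icon from the collation of the restrictions of a pseudo-bifunctor `P` to `P`, given by the
compositors of `P`. -/
def iconLambda : Icon (LaxOn.of (P.restrictLaw hP).collate) (LaxOn.of P.toLax) where
  cell {x y} f := P.toLax.compTo (inL f.1 x.2) (inR y.1 f.2) (factor f)
  cell_naturality {x y f g} η := by
    change (P.toLax.map₂ (a := (x.1, x.2)) (b := (y.1, x.2)) (f := inL f.1 x.2) (g := inL g.1 x.2)
        (η.1, 𝟙 _) ▷ P.toLax.map (inR y.1 f.2) ≫ P.toLax.map (inL g.1 x.2) ◁
          P.toLax.map₂ (a := (y.1, x.2)) (b := (y.1, y.2)) (f := inR y.1 f.2) (g := inR y.1 g.2)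
            (𝟙 _, η.2)) ≫
        P.toLax.compTo (inL g.1 x.2) (inR y.1 g.2) (factor g) =
      P.toLax.compTo (inL f.1 x.2) (inR y.1 f.2) (factor f) ≫ P.toLax.map₂ η
    rw [Category.assoc, whiskerLeft_compTo, whiskerRight_compTo, compTo_map₂]
    congr 1
    exact Prod.ext (by simp) (by simp)
  cell_id x := by
    change ((λ_ _).inv ≫ (P.toLax.restrictData.L x.2).mapId x.1 ▷ 𝟙 (P.toLax.obj x) ≫
      P.toLax.map (𝟙 x) ◁ (P.toLax.restrictData.M x.1).mapId x.2) ≫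
        P.toLax.compTo (𝟙 x) (𝟙 x) (factor (𝟙 x)) = P.toLax.mapId x
    rw [restrictData_mapId_M, restrictData_mapId_L]
    change ((λ_ _).inv ≫ P.toLax.mapId x ▷ 𝟙 (P.toLax.obj x) ≫
      P.toLax.map (𝟙 x) ◁ P.toLax.mapId x) ≫ P.toLax.compTo (𝟙 x) (𝟙 x) (factor (𝟙 x)) = _
    have : (ρ_ (𝟙 x)).inv ≫ factor (𝟙 x) = 𝟙 (𝟙 x) :=
      Prod.ext (by simp) (by simp [unitors_equal])
    simp only [Category.assoc]
    rw [whiskerLeft_mapId_compTo, this, PrelaxFunctor.map₂_id]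
    simp [unitors_inv_equal]
  cell_comp {x y z} f g := by
    let s : inL f.1 x.2 ≫ inL g.1 x.2 ⟶ inL (f.1 ≫ g.1) x.2 := (𝟙 _, (λ_ (𝟙 x.2)).hom)
    let t : inR z.1 f.2 ≫ inR z.1 g.2 ⟶ inR z.1 (f.2 ≫ g.2) := ((ρ_ (𝟙 z.1)).hom, 𝟙 _)
    refine (compTo_interchange P.toLax (P.toLax.restrictσ_mapComp g.1 f.2) s t
      (factor (f ≫ g))).trans (Eq.trans ?_ (compTo_whisker_compTo P.toLax _ _).symm)
    -- The fourfold compositors coincide, leaving a coherence identity in each of `B` and `C`.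
    congr 4
    refine Prod.ext ?_ ?_
    · simp [s, t]; bicategory
    · simp [s, t]; bicategory

theorem isIso_iconLambda_cell {x y : B × C} (f : x ⟶ y) : IsIso ((P.iconLambda hP).cell f) := by
  have : IsIso (factor f) := ⟨((ρ_ f.1).inv, (λ_ f.2).inv), Prod.ext (by simp) (by simp),
    Prod.ext (by simp) (by simp)⟩
  exact P.toLax.isIso_compTo _ _ _

variable {P hP}

/-- This is the composition axiom of `θ` at the factorisation of `f` through `(f.1, 𝟙)` and `(𝟙,
f.2)`: pasting the components of `θ` at the two factors is how collation builds its component at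
`f`. -/
theorem iconLambda_natural {Q : PseudoBifunctor B C D} (hQ : Q.toLax.restrictData.IsDistLaw)
    (θ : P.toLax ⟶ Q.toLax) {x y : B × C} (f : x ⟶ y) :
    (P.iconLambda hP).cell f ▷ θ.app y ≫ θ.naturality f =
      DistHomData.paste (θ.naturality (inL f.1 x.2)) (θ.naturality (inR y.1 f.2)) ≫
        θ.app x ◁ (Q.iconLambda hQ).cell f := by
  refine (compTo_whiskerRight_naturality θ _ _ _).trans ?_
  simp only [DistHomData.paste, Category.assoc]
  rfl

end PseudoBifunctor

/-! ### Assembly into strict 2-natural isomorphisms. -/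

theorem InvDist.eqToHom_hom_app {S T : InvDist B C D} {θ ζ : S ⟶ T} (h : θ = ζ) (b : B) (c : C) :
    (eqToHom h : θ ⟶ ζ).hom.app b c = eqToHom (by rw [h]) := by
  subst h
  rfl

theorem PseudoBifun.eqToHom_hom_app {P Q : PseudoBifun B C D} {θ ζ : P ⟶ Q} (h : θ = ζ)
    (x : B × C) : (eqToHom h : θ ⟶ ζ).hom.as.app x = eqToHom (by rw [h]) := by
  subst h
  rfl

namespace DistLaw

variable (S T : DistLaw B C D) (hS : S.collate.IsPseudo) (hT : T.collate.IsPseudo)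

/-- The distributive law between the restrictions of the collation of `S`. -/
noncomputable abbrev restrictCollate : DistLaw B C D :=
  PseudoBifunctor.restrictLaw ⟨S.collate, hS⟩ S.collate.restrictData_isDistLaw

/-- The comparison `S ⟶ restrictCollate S`. -/
noncomputable def kappaHom : S ⟶ S.restrictCollate hS :=
  { toDistHomData := S.kappaHomData
    yangBaxter := S.kappaHomData_yangBaxter }

/-- The inverse of the comparison `S ⟶ restrictCollate S`. -/
noncomputable def kappaInvHom (h : S.IsInvertible) : S.restrictCollate hS ⟶ S :=
  { toDistHomData := S.kappaInvHomData h
    yangBaxter := S.kappaInvHomData_yangBaxter h }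

variable [Strict D]

theorem kappaHom_comp_kappaInvHom (h : S.IsInvertible) :
    S.kappaHom hS ≫ S.kappaInvHom hS h = 𝟙 S :=
  distHom_ext (fun b c => Strict.id_comp (𝟙 (S.obj b c)))
    (fun b _ _ g => unitCell_comp_unitCell_eqToHom
      ((S.iconM b).cell_comp_inv (isIso_iconM_cell h b) g) _ _)
    (fun c _ _ f => unitCell_comp_unitCell_eqToHom
      ((S.iconL c).cell_comp_inv (isIso_iconL_cell h c) f) _ _)

theorem kappaInvHom_comp_kappaHom (h : S.IsInvertible) :
    S.kappaInvHom hS h ≫ S.kappaHom hS = 𝟙 (S.restrictCollate hS) :=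
  distHom_ext (fun b c => Strict.id_comp (𝟙 (S.obj b c)))
    (fun b _ _ g => unitCell_comp_unitCell_eqToHom
      ((S.iconM b).inv_cell_comp (isIso_iconM_cell h b) g) _ _)
    (fun c _ _ f => unitCell_comp_unitCell_eqToHom
      ((S.iconL c).inv_cell_comp (isIso_iconL_cell h c) f) _ _)

variable {S T}

/-- The restriction of the collation of a morphism of distributive laws. -/
noncomputable def restrictCollateHom (θ : S ⟶ T) : S.restrictCollate hS ⟶ T.restrictCollate hT :=
  PseudoBifunctor.restrictHom S.collate.restrictData_isDistLaw
    T.collate.restrictData_isDistLaw (DistHom.collate θ)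
    (LaxFunctor.restrictHomData_yangBaxter (DistHom.collate θ))

/-- The cells of `κ` are unitors of the families, so its naturality in each variable is the unit
axiom of `θ` in the other variable. -/
theorem comp_kappaHom (θ : S ⟶ T) :
    θ ≫ T.kappaHom hT = S.kappaHom hS ≫ restrictCollateHom hS hT θ :=
  distHom_ext (fun b c => (Strict.comp_id (θ.app b c)).trans (Strict.id_comp (θ.app b c)).symm)
    (fun b c _ g => unitCell_natural_eqToHom
      (unitL_natural ((θ.θB b).naturality g) ((θ.θC c).naturality_id b)) _ _)
    (fun c _ b f => unitCell_natural_eqToHom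
      (unitM_natural ((θ.θC c).naturality f) ((θ.θB b).naturality_id c)) _ _)

end DistLaw

namespace PseudoBifunctor

variable {P Q : PseudoBifunctor B C D} (hP : P.toLax.restrictData.IsDistLaw)
  (hQ : Q.toLax.restrictData.IsDistLaw)

/-- The canonical map from the collation of the restrictions of a pseudo-bifunctor `P` to `P`. -/
noncomputable def lambdaHom : (P.restrictLaw hP).collate ⟶ P.toLax :=
  (P.iconLambda hP).toOplax

/-- The collation of the restrictions of an oplax transformation. -/
noncomputable def collateRestrictHom (θ : P.toLax ⟶ Q.toLax) :
    (P.restrictLaw hP).collate ⟶ (Q.restrictLaw hQ).collate :=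
  DistHom.collate (S := P.restrictLaw hP) (T := Q.restrictLaw hQ)
    (restrictHom hP hQ θ (LaxFunctor.restrictHomData_yangBaxter θ))

theorem collateRestrictHom_comp_lambdaHom [Strict D] (θ : P.toLax ⟶ Q.toLax) :
    collateRestrictHom hP hQ θ ≫ lambdaHom hQ = lambdaHom hP ≫ θ :=
  oplaxTrans_ext (fun a => (Strict.comp_id (θ.app a)).trans (Strict.id_comp (θ.app a)).symm)
    fun f => unitCell_natural_eqToHom (iconLambda_natural (hP := hP) hQ θ f) _ _

end PseudoBifunctor

variable [Strict D]

variable (hK : ∀ S : InvDistLaw B C D, S.toDistLaw.collate.IsPseudo)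
  (hT : ∀ P : PseudoBifunctor B C D, P.toLax.restrictData.IsDistLaw)
  (hT' : ∀ P : PseudoBifunctor B C D, P.toLax.restrictData.IsInvertible)
  (hY : ∀ (P Q : PseudoBifunctor B C D) (θ : P.toLax ⟶ Q.toLax), (restrictHomData θ).YangBaxter)

/-- The components of the isomorphism from the identity to restriction after collation. -/
noncomputable def kappaApp (S : InvDist B C D) :
    (StrictPseudofunctor.id (InvDist B C D)).obj S ⟶
      ((collateFunctor hK).comp (restrictFunctor hT hT' hY)).obj S :=
  InducedBicategory.mkHom (DistLaw.kappaHom (InvDistLaw.toDistLaw S) (hK S))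

theorem kappaApp_naturality {S T : InvDist B C D} (θ : S ⟶ T) :
    (StrictPseudofunctor.id (InvDist B C D)).map θ ≫ kappaApp hK hT hT' hY T =
      kappaApp hK hT hT' hY S ≫ ((collateFunctor hK).comp (restrictFunctor hT hT' hY)).map θ :=
  InducedBicategory.hom_ext (DistLaw.comp_kappaHom (hK S) (hK T) θ.hom)

/-- The strict 2-natural isomorphism from the identity to restriction after collation. -/
noncomputable def kappaIso : TwoNatIso (StrictPseudofunctor.id (InvDist B C D))
    ((collateFunctor hK).comp (restrictFunctor hT hT' hY)) where
  app := kappaApp hK hT hT' hY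
  isIso_app S := ⟨InducedBicategory.mkHom (S.toDistLaw.kappaInvHom (hK S) S.invertible),
    InducedBicategory.hom_ext (S.toDistLaw.kappaHom_comp_kappaInvHom (hK S) S.invertible),
    InducedBicategory.hom_ext (S.toDistLaw.kappaInvHom_comp_kappaHom (hK S) S.invertible)⟩
  naturality := kappaApp_naturality hK hT hT' hY
  naturality₂ {S T θ ζ} Γ := by
    refine InducedBicategory.hom₂_ext (DistLaw.hom₂_ext fun b c => ?_)
    -- The `eqToHom`s between morphisms of distributive laws have `eqToHom`s of `D` as components,
    -- which reduces the claim to `D`.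
    have h₁ := InvDist.eqToHom_hom_app (kappaApp_naturality hK hT hT' hY θ) b c
    have h₂ := InvDist.eqToHom_hom_app (kappaApp_naturality hK hT hT' hY ζ) b c
    exact (congrArg (Γ.hom.app b c ▷ 𝟙 (T.toDistLaw.obj b c) ≫ ·) h₂).trans
      ((whiskerRight_id_comp_eqToHom (Γ.hom.app b c) _ _).trans
        (congrArg (· ≫ 𝟙 (S.toDistLaw.obj b c) ◁ Γ.hom.app b c) h₁.symm))

/-- The components of the isomorphism from collation after restriction to the identity. -/
noncomputable def lambdaApp (P : PseudoBifun B C D) :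
    ((restrictFunctor hT hT' hY).comp (collateFunctor hK)).obj P ⟶
      (StrictPseudofunctor.id (PseudoBifun B C D)).obj P :=
  InducedBicategory.mkHom (PseudoBifunctor.lambdaHom (hT P))

theorem lambdaApp_naturality {P Q : PseudoBifun B C D} (θ : P ⟶ Q) :
    ((restrictFunctor hT hT' hY).comp (collateFunctor hK)).map θ ≫ lambdaApp hK hT hT' hY Q =
      lambdaApp hK hT hT' hY P ≫ (StrictPseudofunctor.id (PseudoBifun B C D)).map θ :=
  InducedBicategory.hom_ext
    (PseudoBifunctor.collateRestrictHom_comp_lambdaHom (hT P) (hT Q) θ.hom)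

/-- The strict 2-natural isomorphism from collation after restriction to the identity. -/
noncomputable def lambdaIso : TwoNatIso ((restrictFunctor hT hT' hY).comp (collateFunctor hK))
    (StrictPseudofunctor.id (PseudoBifun B C D)) where
  app := lambdaApp hK hT hT' hY
  isIso_app P := ⟨InducedBicategory.mkHom
      ((P.iconLambda (hT P)).inv (P.isIso_iconLambda_cell (hT P))).toOplax,
    InducedBicategory.hom_ext (Icon.toOplax_comp_toOplax (Icon.cell_comp_inv _ _)),
    InducedBicategory.hom_ext (Icon.toOplax_comp_toOplax (Icon.inv_cell_comp _ _))⟩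
  naturality := lambdaApp_naturality hK hT hT' hY
  naturality₂ {P Q θ ζ} Γ := by
    refine InducedBicategory.hom₂_ext (Lax.OplaxTrans.homCategory.ext fun x => ?_)
    have h₁ := PseudoBifun.eqToHom_hom_app (lambdaApp_naturality hK hT hT' hY θ) x
    have h₂ := PseudoBifun.eqToHom_hom_app (lambdaApp_naturality hK hT hT' hY ζ) x
    exact (congrArg (Γ.hom.as.app x ▷ 𝟙 (Q.toLax.obj x) ≫ ·) h₂).trans
      ((whiskerRight_id_comp_eqToHom (Γ.hom.as.app x) _ _).trans
        (congrArg (· ≫ 𝟙 (P.toLax.obj x) ◁ Γ.hom.as.app x) h₁.symm))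

end

end CategoryTheory

theorem theorem6 {B : Type u₁} [Bicategory.{w₁, v₁} B] [Strict B]
    {C : Type u₂} [Bicategory.{w₂, v₂} C] [Strict C]
    {D : Type u₃} [Bicategory.{w₃, v₃} D] [Strict D] :
    -- invertible distributive laws of pseudofunctors collate to pseudo-bifunctors
    ∃ (hK : ∀ S : InvDistLaw B C D, S.toDistLaw.collate.IsPseudo)
      -- the restrictions of a pseudo-bifunctor form an invertible distributive law
      (hT : ∀ P : PseudoBifunctor B C D, P.toLax.restrictData.IsDistLaw)
      (hT' : ∀ P : PseudoBifunctor B C D, P.toLax.restrictData.IsInvertible)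
      -- oplax transformations of pseudo-bifunctors restrict to morphisms of distributive laws
      (hY : ∀ (P Q : PseudoBifunctor B C D) (θ : P.toLax ⟶ Q.toLax),
        (restrictHomData θ).YangBaxter)
      -- collation and restriction form an equivalence, with strict 2-natural isomorphisms
      (κ : TwoNatIso (StrictPseudofunctor.id (InvDist B C D))
        ((collateFunctor hK).comp (restrictFunctor hT hT' hY)))
      (lam : TwoNatIso ((restrictFunctor hT hT' hY).comp (collateFunctor hK))
        (StrictPseudofunctor.id (PseudoBifun B C D))),
      -- the components of `κ` are the canonical maps `M b ⟶ P(b, -)` and `L c ⟶ P(-, c)`, and these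
      -- are pseudonatural isomorphisms
      (∀ S : InvDistLaw B C D,
        (∀ b : B, ∃ η : (S.M b).toLax ⟶ (S.collate.fixLeftOn b).toLax,
          HasComponents (S.kappaM b) η ∧ IsPseudonaturalIso η ∧
            ((κ.app S).hom.θB b).toOplax = η) ∧
        (∀ c : C, ∃ η : (S.L c).toLax ⟶ (S.collate.fixRightOn c).toLax,
          HasComponents (S.kappaL c) η ∧ IsPseudonaturalIso η ∧
            ((κ.app S).hom.θC c).toOplax = η)) ∧
      -- the components of `lam` are the canonical maps from the collation of the restrictions of a
      -- pseudo-bifunctor to that pseudo-bifunctor, and these are pseudonatural isomorphisms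
      (∀ P : PseudoBifunctor B C D, ∃ η : (P.restrictLaw (hT P)).collate ⟶ P.toLax,
        HasComponents (F := LaxOn.of (P.restrictLaw (hT P)).collate) (G := LaxOn.of P.toLax)
          (P.lambda (hT P)) η ∧ IsPseudonaturalIso η ∧ (lam.app P).hom = η) := by
  have hK := fun S : InvDistLaw B C D => S.toDistLaw.collate_isPseudo S.invertible
  have hT := fun P : PseudoBifunctor B C D => P.toLax.restrictData_isDistLaw
  have hT' := fun P : PseudoBifunctor B C D => P.toLax.restrictData_isInvertible
  have hY := fun (P Q : PseudoBifunctor B C D) (θ : P.toLax ⟶ Q.toLax) =>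
    LaxFunctor.restrictHomData_yangBaxter θ
  refine ⟨hK, hT, hT', hY, kappaIso hK hT hT' hY, lambdaIso hK hT hT' hY,
    fun S => ⟨fun b => ⟨(S.iconM b).toOplax, ⟨(S.iconM b).toOplaxOn, fun c₁ c₂ g => ?_, rfl⟩,
      (S.iconM b).isPseudonaturalIso (DistLaw.isIso_iconM_cell S.invertible b), rfl⟩,
    fun c => ⟨(S.iconL c).toOplax, ⟨(S.iconL c).toOplaxOn, fun b₁ b₂ f => ?_, rfl⟩,
      (S.iconL c).isPseudonaturalIso (DistLaw.isIso_iconL_cell S.invertible c), rfl⟩⟩,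
    fun P => ⟨(P.iconLambda (hT P)).toOplax,
      ⟨(P.iconLambda (hT P)).toOplaxOn, fun x y f => ?_, rfl⟩,
      (P.iconLambda (hT P)).isPseudonaturalIso (P.isIso_iconLambda_cell (hT P)), rfl⟩⟩
  -- The icon cells and the prescribed components differ only by bracketing, here and in the two
  -- remaining goals.
  · change (ρ_ _).hom ≫ ((λ_ _).inv ≫ (S.L c₁).mapId b ▷ (S.M b).map g) ≫ (λ_ _).inv =
      (ρ_ _).hom ≫ (λ_ _).inv ≫ (S.L c₁).mapId b ▷ (S.M b).map g ≫ (λ_ _).inv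
    rw [Category.assoc]
  · change (ρ_ _).hom ≫ ((ρ_ _).inv ≫ (S.L c).map f ◁ (S.M b₂).mapId c) ≫ (λ_ _).inv =
      (ρ_ _).hom ≫ (ρ_ _).inv ≫ (S.L c).map f ◁ (S.M b₂).mapId c ≫ (λ_ _).inv
    rw [Category.assoc]
  · exact congrArg ((ρ_ _).hom ≫ ·) (Category.assoc _ _ _)
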